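/- Let $M$ be a smooth $n$-dimensional manifold without boundary (Hausdorff, second countable, $n\ge 0$) and $A=C^\infty(M)$ its algebra of smooth real functions. For $m\ge 0$ let $D^{m-1}_{poly}(M)$ be the $A$-module of multidifferential operators with $m$ arguments: the $\mathbb R$-multilinear maps $D:A^{m}\to A$ for which there is a finite set $S$ of $m$-tuples $(J_0,\dots,J_{m-1})$ of multi-indices such that in every smooth chart $$D(f_0,\dots,f_{m-1})=\sum_{(J_0,\dots,J_{m-1})\in S} C^{J_0,\dots,J_{m-1}}\,\partial_{J_0}f_0\cdots\partial_{J_{m-1}}f_{m-1}$$ with smooth coefficients $C^{J_0,\dots,J_{m-1}}$ on the domain of the chart. Let $\mathrm d$ be the Hochschild differential, given for $\varphi$ with $m$ arguments by $$(-1)^m(\mathrm d\varphi)(f_0,\dots,f_m)=f_0\varphi(f_1,\dots,f_m)+\sum_{i=0}^{m-1}(-1)^{i+1}\varphi(f_0,\dots,f_if_{i+1},\dots,f_m)+(-1)^{m+1}\varphi(f_0,\dots,f_{m-1})f_m,$$ and let $$H^1(D_{poly}(M))=\frac{\{B\in D^1_{poly}(M):\mathrm dB=0\}}{\{\mathrm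 dT: T\in D^0_{poly}(M)\}}.$$ Let $T^1_{poly}(M)=\Gamma(\Lambda^2TM)$ be the $A$-module of smooth bivector fields on $M$, and let $U_1$ send a bivector field $\alpha$ to $U_1(\alpha)(f,g)=\tfrac12\langle \mathrm df\wedge \mathrm dg,\alpha\rangle$, where $\langle\cdot,\cdot\rangle$ is the determinant pairing, so that $U_1(X\wedge Y)(f,g)=\tfrac12\big(X(f)Y(g)-Y(f)X(g)\big)$. Then, for every $\alpha\in T^1_{poly}(M)$, $U_1(\alpha)$ is a bidifferential operator and a Hochschild cocycle, and $\alpha\mapsto[U_1(\alpha)]$ is an isomorphism of $A$-modules $$T^1_{poly}(M)\;\cong\;H^1(D_{poly}(M)).$$ -/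

import Mathlib

open scoped Manifold ContDiff

noncomputable section

/-! ### The Hochschild complex of a commutative algebra -/

/-- `K`-multilinear maps `A × ⋯ × A → A` with `m` arguments, that is `Hom_K(A^{⊗ m}, A)`. This is
the component of degree `m - 1` of the Hochschild complex. -/
def HochschildCochain (K A : Type*) [CommRing K] [CommRing A] [Algebra K A] (m : ℕ) : Type _ :=
  MultilinearMap K (fun _ : Fin m => A) A

namespace HochschildCochain

variable {K A : Type*} [CommRing K] [CommRing A] [Algebra K A] {m : ℕ}

instance : AddCommGroup (HochschildCochain K A m) :=
  inferInstanceAs (AddCommGroup (MultilinearMap K (fun _ : Fin m => A) A))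

/-- `A` acts by multiplication of the values. -/
instance : Module A (HochschildCochain K A m) :=
  inferInstanceAs (Module A (MultilinearMap K (fun _ : Fin m => A) A))

instance : FunLike (HochschildCochain K A m) (Fin m → A) A :=
  inferInstanceAs (FunLike (MultilinearMap K (fun _ : Fin m => A) A) (Fin m → A) A)

@[ext]
theorem ext {φ ψ : HochschildCochain K A m} (h : ∀ f, φ f = ψ f) : φ = ψ :=
  DFunLike.ext _ _ h

@[simp]
theorem add_apply (φ ψ : HochschildCochain K A m) (f : Fin m → A) : (φ + ψ) f = φ f + ψ f := rfl

@[simp]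
theorem smul_apply (a : A) (φ : HochschildCochain K A m) (f : Fin m → A) :
    (a • φ) f = a * φ f := rfl

theorem map_update_add (φ : HochschildCochain K A m) (f : Fin m → A) (j : Fin m) (x y : A) :
    φ (Function.update f j (x + y)) = φ (Function.update f j x) + φ (Function.update f j y) :=
  MultilinearMap.map_update_add φ f j x y

theorem map_update_smul (φ : HochschildCochain K A m) (f : Fin m → A) (j : Fin m) (c : K) (x : A) :
    φ (Function.update f j (c • x)) = c • φ (Function.update f j x) :=
  MultilinearMap.map_update_smul φ f j c x

/-- `(f₀, …, f_m) ↦ f₀ φ(f₁, …, f_m)`. -/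
def front (φ : HochschildCochain K A m) : HochschildCochain K A (m + 1) :=
  MultilinearMap.mk' (fun f => f 0 * φ (Fin.tail f))
    (fun f j x y => by
      refine Fin.cases ?_ (fun j => ?_) j
      · simp [Fin.tail_update_zero, add_mul]
      · simp [Fin.tail_update_succ, mul_add, map_update_add, Function.update_of_ne (Fin.succ_ne_zero j).symm])
    (fun f j c x => by
      refine Fin.cases ?_ (fun j => ?_) j
      · simp [Fin.tail_update_zero]
      · simp [Fin.tail_update_succ, map_update_smul, Function.update_of_ne (Fin.succ_ne_zero j).symm])

/-- `(f₀, …, f_m) ↦ φ(f₀, …, f_{m-1}) f_m`. -/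
def back (φ : HochschildCochain K A m) : HochschildCochain K A (m + 1) :=
  MultilinearMap.mk' (fun f => φ (Fin.init f) * f (Fin.last m))
    (fun f j x y => by
      refine Fin.lastCases ?_ (fun j => ?_) j
      · simp [Fin.init_update_last, mul_add]
      · simp [Fin.init_update_castSucc, add_mul, map_update_add,
          Function.update_of_ne (Fin.castSucc_lt_last j).ne'])
    (fun f j c x => by
      refine Fin.lastCases ?_ (fun j => ?_) j
      · simp [Fin.init_update_last]
      · simp [Fin.init_update_castSucc, map_update_smul,
          Function.update_of_ne (Fin.castSucc_lt_last j).ne'])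

theorem contractNth_update (i : Fin m) (f : Fin (m + 1) → A) (j : Fin (m + 1)) (x : A) :
    Fin.contractNth i.castSucc (· * ·) (Function.update f j x) =
      Function.update (Fin.contractNth i.castSucc (· * ·) f) (i.predAbove j)
        (if j = i.castSucc then x * f i.succ else if j = i.succ then f i.castSucc * x else x) := by
  funext k
  rcases i with ⟨i, hi⟩
  rcases j with ⟨j, hj⟩
  rcases k with ⟨k, hk⟩
  simp only [Fin.contractNth, Function.update_apply, Fin.predAbove, Fin.ext_iff, Fin.lt_def,
    Fin.val_castSucc, Fin.val_succ]
  split_ifs <;> simp_all <;> first | rfl | omega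

/-- `(f₀, …, f_m) ↦ φ(f₀, …, f_{i-1}, f_i f_{i+1}, f_{i+2}, …, f_m)`. -/
def contract (i : Fin m) (φ : HochschildCochain K A m) : HochschildCochain K A (m + 1) :=
  MultilinearMap.mk' (fun f => φ (Fin.contractNth i.castSucc (· * ·) f))
    (fun f j x y => by
      simp only [contractNth_update]
      rw [← φ.map_update_add]
      split_ifs <;> simp [add_mul, mul_add])
    (fun f j c x => by
      simp only [contractNth_update]
      rw [← φ.map_update_smul]
      split_ifs <;> simp)

/-- The Hochschild differential: for `φ` with `m` arguments,
`(-1)^m (dφ)(f₀, …, f_m) = ∑_{i < m} (-1)^{i+1} φ(f₀, …, f_i f_{i+1}, …, f_m)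
  + f₀ φ(f₁, …, f_m) + (-1)^{m-1} φ(f₀, …, f_{m-1}) f_m`.
(The last sign is written `(-1)^{m+1}`, to make sense for `m = 0`.) -/
def differential (K A : Type*) [CommRing K] [CommRing A] [Algebra K A] (m : ℕ) :
    HochschildCochain K A m →ₗ[A] HochschildCochain K A (m + 1) where
  toFun φ := (-1 : A) ^ m • (∑ i : Fin m, (-1 : A) ^ ((i : ℕ) + 1) • φ.contract i
    + φ.front + (-1 : A) ^ (m + 1) • φ.back)
  map_add' φ ψ := by
    have h1 (i : Fin m) : (φ + ψ).contract i = φ.contract i + ψ.contract i := rfl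
    have h2 : (φ + ψ).front = φ.front + ψ.front := ext fun f => mul_add _ _ _
    have h3 : (φ + ψ).back = φ.back + ψ.back := ext fun f => add_mul _ _ _
    simp only [h1, h2, h3, smul_add, Finset.sum_add_distrib]
    abel
  map_smul' a φ := by
    have h1 (i : Fin m) : (a • φ).contract i = a • φ.contract i := rfl
    have h2 : (a • φ).front = a • φ.front := ext fun f => mul_left_comm _ _ _
    have h3 : (a • φ).back = a • φ.back := ext fun f => mul_assoc _ _ _
    simp only [h1, h2, h3, smul_add, Finset.smul_sum, smul_comm a, RingHom.id_apply]

variable (D : ∀ m : ℕ, Submodule A (HochschildCochain K A m))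

/-- For a family `D` of `A`-submodules of the Hochschild cochains (`D m` consisting of cochains
with `m` arguments), the cocycles of degree `k`: elements of `D (k + 1)` killed by the
differential. -/
def cocycles (k : ℕ) : Submodule A (HochschildCochain K A (k + 1)) :=
  D (k + 1) ⊓ LinearMap.ker (differential K A (k + 1))

/-- The coboundaries of degree `k`: the `dψ` with `ψ` in `D k`. -/
def coboundaries (k : ℕ) : Submodule A (HochschildCochain K A (k + 1)) :=
  (D k).map (differential K A k)

/-- The cohomology in degree `k` of the subcomplex `D`: cocycles modulo coboundaries. -/
abbrev Cohomology (k : ℕ) : Type _ :=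
  cocycles D k ⧸ (coboundaries D k).submoduleOf (cocycles D k)

/-- The cohomology class of a cocycle. -/
abbrev cohomologyClass (k : ℕ) : cocycles D k →ₗ[A] Cohomology D k :=
  ((coboundaries D k).submoduleOf (cocycles D k)).mkQ

end HochschildCochain

/-! ### Multidifferential operators on a manifold -/

/-- The algebra `C^∞(M)` of smooth real functions on an `n`-dimensional manifold. -/
abbrev SmoothFun (n : ℕ) (M : Type*) [TopologicalSpace M]
    [ChartedSpace (EuclideanSpace ℝ (Fin n)) M] : Type _ :=
  C^∞⟮𝓡 n, M; ℝ⟯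

/-- The partial derivative `∂_i F` of a function on `ℝⁿ`. -/
def partialDeriv {n : ℕ} (i : Fin n) (F : EuclideanSpace ℝ (Fin n) → ℝ) :
    EuclideanSpace ℝ (Fin n) → ℝ :=
  fun x => fderiv ℝ F x (EuclideanSpace.single i 1)

/-- The iterated partial derivative `∂_J F = ∂_0^{J 0} ⋯ ∂_{n-1}^{J (n-1)} F` for a multi-index
`J`. -/
def multiPartialDeriv {n : ℕ} (J : Fin n → ℕ) (F : EuclideanSpace ℝ (Fin n) → ℝ) :
    EuclideanSpace ℝ (Fin n) → ℝ :=
  (List.finRange n).foldr (fun i G => (partialDeriv i)^[J i] G) F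

section Manifold

variable (n : ℕ) (M : Type*) [TopologicalSpace M] [ChartedSpace (EuclideanSpace ℝ (Fin n)) M]

/-- `D` is a multidifferential operator with `m` arguments: there is a finite set `S` of tuples
of multi-indices such that in all local coordinates (every chart `e` of the maximal smooth atlas)
`D(f₀, …, f_{m-1}) = ∑_{J ∈ S} C^J ∂_{J 0} f₀ ⋯ ∂_{J (m-1)} f_{m-1}`
with smooth coefficients `C^J` on the domain of the chart. -/
def IsMultidifferentialOperator {n : ℕ} {M : Type*} [TopologicalSpace M]
    [ChartedSpace (EuclideanSpace ℝ (Fin n)) M] {m : ℕ}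
    (D : HochschildCochain ℝ (SmoothFun n M) m) : Prop :=
  ∃ S : Finset (Fin m → Fin n → ℕ), ∀ e ∈ IsManifold.maximalAtlas (𝓡 n) ∞ M,
    ∃ C : (Fin m → Fin n → ℕ) → M → ℝ,
      (∀ J, ContMDiffOn (𝓡 n) 𝓘(ℝ, ℝ) ∞ (C J) e.source) ∧
      ∀ (f : Fin m → SmoothFun n M), ∀ p ∈ e.source,
        D f p = ∑ J ∈ S, C J p * ∏ k, multiPartialDeriv (J k) (f k ∘ e.symm) (e p)

/-- The multidifferential operators with `m` arguments, that is `D_poly^{m-1}(M)`. -/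
def Dpoly (m : ℕ) : Submodule (SmoothFun n M) (HochschildCochain ℝ (SmoothFun n M) m) where
  carrier := {D | IsMultidifferentialOperator D}
  zero_mem' := ⟨∅, fun _ _ => ⟨fun _ _ => 0, fun _ => contMDiffOn_const, fun _ _ _ => rfl⟩⟩
  add_mem' := by
    classical
    rintro D D' ⟨S, hS⟩ ⟨S', hS'⟩
    refine ⟨S ∪ S', fun e he => ?_⟩
    obtain ⟨C, hC, h⟩ := hS e he
    obtain ⟨C', hC', h'⟩ := hS' e he
    refine ⟨fun J p => (if J ∈ S then C J p else 0) + (if J ∈ S' then C' J p else 0),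
      fun J => ?_, fun f p hp => ?_⟩
    · refine ContMDiffOn.add ?_ ?_ <;> split_ifs
      exacts [hC J, contMDiffOn_const, hC' J, contMDiffOn_const]
    · have : (D + D') f p = D f p + D' f p := rfl
      rw [this, h f p hp, h' f p hp]
      simp only [add_mul, Finset.sum_add_distrib, ite_mul, zero_mul, Finset.sum_ite_mem,
        Finset.union_inter_cancel_left, Finset.union_inter_cancel_right]
  smul_mem' := by
    rintro a D ⟨S, hS⟩
    refine ⟨S, fun e he => ?_⟩
    obtain ⟨C, hC, h⟩ := hS e he
    refine ⟨fun J p => a p * C J p, fun J => a.contMDiff.contMDiffOn.mul (hC J),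
      fun f p hp => ?_⟩
    have : (a • D) f p = a p * D f p := rfl
    rw [this, h f p hp, Finset.mul_sum]
    simp only [mul_assoc]

/-! ### Multivector fields -/

/-- The coordinate vector `∂_i` at `p` of a chart `e` of `M`. -/
def coordVector {n : ℕ} {M : Type*} [TopologicalSpace M]
    [ChartedSpace (EuclideanSpace ℝ (Fin n)) M]
    (e : OpenPartialHomeomorph M (EuclideanSpace ℝ (Fin n))) (i : Fin n) (p : M) :
    TangentSpace (𝓡 n) p :=
  mfderiv (𝓡 n) (𝓡 n) e.symm (e p) (EuclideanSpace.single i (1 : ℝ))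

/-- A multivector field of degree `k`, that is an element of `𝔛^k(M) = Γ(Λ^k TM)`: a section
of the `k`-th exterior power of the tangent bundle that can be written in every chart of
the maximal smooth atlas as `∑_s a_s ∂_{s 0} ∧ ⋯ ∧ ∂_{s (k-1)}` with smooth coefficients. -/
@[ext]
structure MultivectorField (k : ℕ) where
  toFun : ∀ p : M, ⋀[ℝ]^k (TangentSpace (𝓡 n) p)
  smooth' : ∀ e ∈ IsManifold.maximalAtlas (𝓡 n) ∞ M, ∃ a : (Fin k → Fin n) → M → ℝ,
    (∀ s, ContMDiffOn (𝓡 n) 𝓘(ℝ, ℝ) ∞ (a s) e.source) ∧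
    ∀ p ∈ e.source, toFun p =
      ∑ s, a s p • exteriorPower.ιMulti ℝ k (fun j => coordVector e (s j) p)

namespace MultivectorField

variable {n M} {k : ℕ}

instance : Zero (MultivectorField n M k) :=
  ⟨fun _ => 0, fun _ _ => ⟨fun _ _ => 0, fun _ => contMDiffOn_const, fun _ _ => by simp⟩⟩

instance : Add (MultivectorField n M k) :=
  ⟨fun α β => ⟨fun p => α.toFun p + β.toFun p, fun e he => by
    obtain ⟨a, ha, h⟩ := α.smooth' e he
    obtain ⟨b, hb, h'⟩ := β.smooth' e he
    exact ⟨fun s p => a s p + b s p, fun s => (ha s).add (hb s), fun p hp => by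
      rw [h p hp, h' p hp]; simp only [add_smul, Finset.sum_add_distrib]⟩⟩⟩

instance : Neg (MultivectorField n M k) :=
  ⟨fun α => ⟨fun p => -α.toFun p, fun e he => by
    obtain ⟨a, ha, h⟩ := α.smooth' e he
    exact ⟨fun s p => -a s p, fun s => (ha s).neg, fun p hp => by
      rw [h p hp, ← Finset.sum_neg_distrib]
      exact Finset.sum_congr rfl fun s _ => (neg_smul _ _).symm⟩⟩⟩

/-- Pointwise multiplication by a smooth function. -/
instance : SMul (SmoothFun n M) (MultivectorField n M k) :=
  ⟨fun f α => ⟨fun p => f p • α.toFun p, fun e he => by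
    obtain ⟨a, ha, h⟩ := α.smooth' e he
    exact ⟨fun s p => f p * a s p, fun s => f.contMDiff.contMDiffOn.mul (ha s), fun p hp => by
      rw [h p hp]; simp only [Finset.smul_sum, mul_smul]⟩⟩⟩

instance : AddCommGroup (MultivectorField n M k) where
  add_assoc _ _ _ := MultivectorField.ext (funext fun _ => add_assoc _ _ _)
  zero_add _ := MultivectorField.ext (funext fun _ => zero_add _)
  add_zero _ := MultivectorField.ext (funext fun _ => add_zero _)
  add_comm _ _ := MultivectorField.ext (funext fun _ => add_comm _ _)
  neg_add_cancel _ := MultivectorField.ext (funext fun _ => neg_add_cancel _)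
  nsmul := nsmulRec
  zsmul := zsmulRec

instance : Module (SmoothFun n M) (MultivectorField n M k) where
  one_smul _ := MultivectorField.ext (funext fun _ => one_smul _ _)
  mul_smul _ _ _ := MultivectorField.ext (funext fun _ => mul_smul _ _ _)
  smul_zero _ := MultivectorField.ext (funext fun _ => smul_zero _)
  smul_add _ _ _ := MultivectorField.ext (funext fun _ => smul_add _ _ _)
  add_smul _ _ _ := MultivectorField.ext (funext fun _ => add_smul _ _ _)
  zero_smul _ := MultivectorField.ext (funext fun _ => zero_smul _ _)

end MultivectorField

/-- `T_poly^k(M) = 𝔛^{k+1}(M)`. -/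
abbrev Tpoly (k : ℕ) : Type _ := MultivectorField n M (k + 1)

/-! ### The Hochschild-Kostant-Rosenberg map -/

/-- The differential `df` at `p` as a linear form on the tangent space. -/
def differentialAt {n : ℕ} {M : Type*} [TopologicalSpace M]
    [ChartedSpace (EuclideanSpace ℝ (Fin n)) M] (f : SmoothFun n M) (p : M) :
    Module.Dual ℝ (TangentSpace (𝓡 n) p) :=
  (mfderiv (𝓡 n) 𝓘(ℝ, ℝ) f p : TangentSpace (𝓡 n) p →L[ℝ] ℝ).toLinearMap

/-- The value at `p` of the function `U₁(α)(f₀, …, f_{k-1})`: the number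
`(1 / k!) ⟨df₀ ∧ ⋯ ∧ df_{k-1}, α⟩` at `p`, where `⟨·, ·⟩` is the determinant pairing
of exterior powers. -/
def hkrValue {n : ℕ} {M : Type*} [TopologicalSpace M]
    [ChartedSpace (EuclideanSpace ℝ (Fin n)) M] {k : ℕ}
    (α : MultivectorField n M k) (f : Fin k → SmoothFun n M) (p : M) : ℝ :=
  (1 / (k.factorial : ℝ)) *
    exteriorPower.pairingDual ℝ (TangentSpace (𝓡 n) p) k
      (exteriorPower.ιMulti ℝ k (fun j => differentialAt (f j) p)) (α.toFun p)

/-- On a field equal at `p` to `X₀ ∧ ⋯ ∧ X_{k-1}`, the value is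
`(1 / k!) ∑_σ sgn(σ) ∏_i X_{σ i}(f_i)`. -/
theorem hkrValue_wedge {n : ℕ} {M : Type*} [TopologicalSpace M]
    [ChartedSpace (EuclideanSpace ℝ (Fin n)) M] {k : ℕ}
    (α : MultivectorField n M k) (f : Fin k → SmoothFun n M) (p : M)
    (X : Fin k → TangentSpace (𝓡 n) p) (hX : α.toFun p = exteriorPower.ιMulti ℝ k X) :
    hkrValue α f p = (1 / (k.factorial : ℝ)) *
      ∑ σ : Equiv.Perm (Fin k), (Equiv.Perm.sign σ : ℝ) *
        ∏ i, differentialAt (f i) p (X (σ i)) := by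
  rw [hkrValue, hX, exteriorPower.pairingDual_ιMulti_ιMulti, Matrix.det_apply']
  simp

end Manifold

end

/-! ### Iterated partial derivatives on open subsets of `ℝⁿ` -/

section PartialDerivatives

variable {n : ℕ} {U : Set (EuclideanSpace ℝ (Fin n))} {F G : EuclideanSpace ℝ (Fin n) → ℝ}

/-! Fix a point `p` and a chart `e`, and test a bidifferential operator `B` at `p` on germs `exp (ξ
· (x - e p))` and `exp (η · (x - e p))`. The result is a polynomial `s(ξ, η)`, the symbol of `B` at
`p` (`bisymbol`). These exponentials take the value 1 at `p`, and multiplying them adds frequencies.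
The Hochschild cocycle condition therefore becomes the cocycle identity of the additive group `ℝⁿ`:
`s(η, ζ) - s(ξ + η, ζ) + s(ξ, η + ζ) - s(ξ, η) = 0` (`bisymbol_cocycle`). Conversely, a functional
of finite order at `p` that vanishes on exponentials is zero (`eq_zero_of_mem_jetFunctionals`),
because a polynomial vanishing on real points has zero coefficients. So identities between symbols
lift back to operators.

Two facts about group cocycles carry the argument. The antisymmetrization of a continuous cocycle is
bilinear (`antisymm_eq_sum_of_cocycle`), so `B(f, g) - B(g, f)` has first order in each argument and
comes from a bivector field (`exists_hkrCochain_eq_antisymm`). A symmetric differentiable cocycle is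
determined, up to its value at 0, by its first-order part in the first variable; integrating that
part along rays gives a primitive (`coboundary_of_symm_cocycle`). For a symbol this primitive is
explicit, with coefficients depending smoothly on the point and order bounded independently of the
chart. Local primitives are then glued by a partition of unity, which preserves the coboundary
equation because that equation is linear in the primitive over functions
(`mem_coboundaries_of_symm`).

Surjectivity: if `U₁(α)` is the antisymmetric part of `B`, then `U₁(α) - B` is a symmetric cocycle,
hence a coboundary. Injectivity: coboundaries are symmetric because `C^∞(M)` is commutative, while
`U₁(α)` is antisymmetric; and `U₁(α) = 0` forces `α = 0`, since differentials of functions fill each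
cotangent space. -/

theorem contDiffOn_partialDeriv (hU : IsOpen U) (hF : ContDiffOn ℝ ∞ F U) (i : Fin n) :
    ContDiffOn ℝ ∞ (partialDeriv i F) U :=
  (hF.fderiv_of_isOpen hU (by simp)).clm_apply contDiffOn_const

theorem partialDeriv_eqOn (hU : IsOpen U) (h : Set.EqOn F G U) (i : Fin n) :
    Set.EqOn (partialDeriv i F) (partialDeriv i G) U := fun x hx => by
  unfold partialDeriv
  rw [(h.eventuallyEq_of_mem (hU.mem_nhds hx)).fderiv_eq]

theorem differentiableAt_of_contDiffOn (hU : IsOpen U) (hF : ContDiffOn ℝ ∞ F U)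
    {x : EuclideanSpace ℝ (Fin n)} (hx : x ∈ U) : DifferentiableAt ℝ F x :=
  (hF.contDiffAt (hU.mem_nhds hx)).differentiableAt (by simp)

theorem partialDeriv_comm (hU : IsOpen U) (hF : ContDiffOn ℝ ∞ F U) (i j : Fin n) :
    Set.EqOn (partialDeriv i (partialDeriv j F)) (partialDeriv j (partialDeriv i F)) U := by
  intro x hx
  have hF' : ContDiffAt ℝ ∞ F x := hF.contDiffAt (hU.mem_nhds hx)
  have hd : DifferentiableAt ℝ (fderiv ℝ F) x :=
    (hF'.fderiv_right (m := 1) (WithTop.coe_le_coe.2 le_top)).differentiableAt (by simp)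
  have key (v w : EuclideanSpace ℝ (Fin n)) :
      fderiv ℝ (fun y => fderiv ℝ F y v) x w = fderiv ℝ (fderiv ℝ F) x w v := by
    rw [fderiv_clm_apply hd (differentiableAt_const v)]
    simp
  have hs : IsSymmSndFDerivAt ℝ F x := by
    refine hF'.isSymmSndFDerivAt ?_
    simp only [minSmoothness_of_isRCLikeNormedField]
    exact WithTop.coe_le_coe.2 le_top
  unfold partialDeriv
  rw [key, key]
  exact hs _ _

theorem partialDeriv_mul {x : EuclideanSpace ℝ (Fin n)} (hF : DifferentiableAt ℝ F x)
    (hG : DifferentiableAt ℝ G x) (i : Fin n) :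
    partialDeriv i (fun y => F y * G y) x = partialDeriv i F x * G x + F x * partialDeriv i G x := by
  unfold partialDeriv
  rw [fderiv_fun_mul hF hG]
  simp [mul_comm, add_comm]

theorem partialDeriv_add {x : EuclideanSpace ℝ (Fin n)} (hF : DifferentiableAt ℝ F x)
    (hG : DifferentiableAt ℝ G x) (i : Fin n) :
    partialDeriv i (fun y => F y + G y) x = partialDeriv i F x + partialDeriv i G x := by
  unfold partialDeriv
  rw [fderiv_fun_add hF hG]
  simp

theorem partialDeriv_const_mul {x : EuclideanSpace ℝ (Fin n)} (hF : DifferentiableAt ℝ F x)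
    (c : ℝ) (i : Fin n) : partialDeriv i (fun y => c * F y) x = c * partialDeriv i F x := by
  unfold partialDeriv
  rw [fderiv_const_mul hF]
  simp

theorem partialDeriv_sum {ι : Type*} (s : Finset ι) {H : ι → EuclideanSpace ℝ (Fin n) → ℝ}
    {x : EuclideanSpace ℝ (Fin n)} (hH : ∀ k ∈ s, DifferentiableAt ℝ (H k) x) (i : Fin n) :
    partialDeriv i (fun y => ∑ k ∈ s, H k y) x = ∑ k ∈ s, partialDeriv i (H k) x := by
  unfold partialDeriv
  rw [fderiv_fun_sum hH]
  simp

/-- The iterated partial derivative along a list of indices. -/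
noncomputable def listDeriv (l : List (Fin n)) (F : EuclideanSpace ℝ (Fin n) → ℝ) :
    EuclideanSpace ℝ (Fin n) → ℝ :=
  l.foldr partialDeriv F

@[simp] theorem listDeriv_nil : listDeriv [] F = F := rfl

@[simp] theorem listDeriv_cons (i : Fin n) (l : List (Fin n)) :
    listDeriv (i :: l) F = partialDeriv i (listDeriv l F) := rfl

theorem contDiffOn_listDeriv (hU : IsOpen U) (hF : ContDiffOn ℝ ∞ F U) (l : List (Fin n)) :
    ContDiffOn ℝ ∞ (listDeriv l F) U := by
  induction l with
  | nil => exact hF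
  | cons i l ih => exact contDiffOn_partialDeriv hU ih i

theorem listDeriv_eqOn (hU : IsOpen U) (h : Set.EqOn F G U) (l : List (Fin n)) :
    Set.EqOn (listDeriv l F) (listDeriv l G) U := by
  induction l with
  | nil => exact h
  | cons i l ih => exact partialDeriv_eqOn hU ih i

/-- Adjacent transpositions generate all permutations, and each one is an instance of the symmetry
of second derivatives. -/
theorem listDeriv_perm (hU : IsOpen U) (hF : ContDiffOn ℝ ∞ F U) {l l' : List (Fin n)}
    (h : l.Perm l') : Set.EqOn (listDeriv l F) (listDeriv l' F) U := by
  induction h with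
  | nil => exact fun _ _ => rfl
  | cons i _ ih => exact partialDeriv_eqOn hU ih i
  | swap i j l => exact partialDeriv_comm hU (contDiffOn_listDeriv hU hF l) j i
  | trans _ _ ih ih' => exact ih.trans ih'

/-- The list containing `J i` times the index `i`. -/
def multiIndexList (J : Fin n → ℕ) : List (Fin n) :=
  (List.finRange n).flatMap fun i => List.replicate (J i) i

/-- Lists allow the Leibniz and chain rules to be proved by adding one derivative at a time; the
exponents of a multi-index would need bookkeeping. -/
theorem multiPartialDeriv_eq_listDeriv (J : Fin n → ℕ) :
    multiPartialDeriv J F = listDeriv (multiIndexList J) F := by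
  unfold multiPartialDeriv multiIndexList listDeriv
  induction List.finRange n with
  | nil => rfl
  | cons i L ih =>
    rw [List.foldr_cons, ih, List.flatMap_cons, List.foldr_append]
    generalize List.foldr partialDeriv F _ = H
    induction J i with
    | zero => rfl
    | succ k ihk => rw [Function.iterate_succ_apply', ihk, List.replicate_succ, List.foldr_cons]

theorem count_multiIndexList (J : Fin n → ℕ) (i : Fin n) : (multiIndexList J).count i = J i := by
  rw [multiIndexList, List.count_flatMap]
  have : (List.count i ∘ fun j => List.replicate (J j) j) = fun j => if j = i then J i else 0 := by
    funext j
    simp only [Function.comp, List.count_replicate, beq_iff_eq]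
    split_ifs with h
    · rw [h]
    · rfl
  rw [this, ← List.ofFn_eq_map, List.sum_ofFn]
  simp

theorem length_multiIndexList (J : Fin n → ℕ) : (multiIndexList J).length = ∑ i, J i := by
  simp only [← count_multiIndexList J]
  rw [← List.sum_toFinset_count_eq_length]
  exact Finset.sum_subset (Finset.subset_univ _) fun i _ hi => by
    simpa [List.count_eq_zero] using hi

theorem listDeriv_eq_multiPartialDeriv (hU : IsOpen U) (hF : ContDiffOn ℝ ∞ F U)
    (l : List (Fin n)) :
    Set.EqOn (listDeriv l F) (multiPartialDeriv (fun i => l.count i) F) U := by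
  rw [multiPartialDeriv_eq_listDeriv]
  refine listDeriv_perm hU hF (List.perm_iff_count.2 fun i => ?_)
  rw [count_multiIndexList]

theorem listDeriv_add (hU : IsOpen U) (hF : ContDiffOn ℝ ∞ F U) (hG : ContDiffOn ℝ ∞ G U)
    (l : List (Fin n)) :
    Set.EqOn (listDeriv l (fun y => F y + G y)) (fun y => listDeriv l F y + listDeriv l G y) U := by
  induction l with
  | nil => exact fun _ _ => rfl
  | cons i l ih =>
    exact (partialDeriv_eqOn hU ih i).trans fun x hx => partialDeriv_add
      (differentiableAt_of_contDiffOn hU (contDiffOn_listDeriv hU hF l) hx)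
      (differentiableAt_of_contDiffOn hU (contDiffOn_listDeriv hU hG l) hx) i

theorem listDeriv_const_mul (hU : IsOpen U) (hF : ContDiffOn ℝ ∞ F U) (c : ℝ)
    (l : List (Fin n)) :
    Set.EqOn (listDeriv l (fun y => c * F y)) (fun y => c * listDeriv l F y) U := by
  induction l with
  | nil => exact fun _ _ => rfl
  | cons i l ih =>
    exact (partialDeriv_eqOn hU ih i).trans fun x hx => partialDeriv_const_mul
      (differentiableAt_of_contDiffOn hU (contDiffOn_listDeriv hU hF l) hx) c i

/-- The Leibniz rule for iterated partial derivatives. -/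
theorem exists_listDeriv_mul (l : List (Fin n)) :
    ∃ L : List (List (Fin n) × List (Fin n)),
      ∀ {U : Set (EuclideanSpace ℝ (Fin n))} {F G : EuclideanSpace ℝ (Fin n) → ℝ}, IsOpen U →
        ContDiffOn ℝ ∞ F U → ContDiffOn ℝ ∞ G U →
        Set.EqOn (listDeriv l (fun y => F y * G y))
          (fun y => (L.map fun a => listDeriv a.1 F y * listDeriv a.2 G y).sum) U := by
  induction l with
  | nil => exact ⟨[([], [])], fun _ _ _ _ _ => by simp⟩
  | cons i l ih =>
    obtain ⟨L, hL⟩ := ih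
    -- Each term splits in two under the new derivative. Repeated pairs stay in the list, so no
    -- binomial coefficients appear.
    refine ⟨L.flatMap fun a => [(i :: a.1, a.2), (a.1, i :: a.2)], fun {U F G} hU hF hG => ?_⟩
    refine (partialDeriv_eqOn hU (hL hU hF hG) i).trans fun x hx => ?_
    have hd {H : EuclideanSpace ℝ (Fin n) → ℝ} (hH : ContDiffOn ℝ ∞ H U) (a : List (Fin n)) :
        DifferentiableAt ℝ (listDeriv a H) x :=
      differentiableAt_of_contDiffOn hU (contDiffOn_listDeriv hU hH a) hx
    have key : DifferentiableAt ℝ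
          (fun y => (L.map fun a => listDeriv a.1 F y * listDeriv a.2 G y).sum) x ∧
        partialDeriv i (fun y => (L.map fun a => listDeriv a.1 F y * listDeriv a.2 G y).sum) x =
          ((L.flatMap fun a => [(i :: a.1, a.2), (a.1, i :: a.2)]).map
            fun a => listDeriv a.1 F x * listDeriv a.2 G x).sum := by
      clear hL
      induction L with
      | nil => simp [partialDeriv]
      | cons a L ih =>
        have h1 := (hd hF a.1).fun_mul (hd hG a.2)
        simp only [List.map_cons, List.sum_cons, List.flatMap_cons, List.map_append,
          List.sum_append]
        refine ⟨h1.fun_add ih.1, ?_⟩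
        rw [partialDeriv_add h1 ih.1, ih.2, partialDeriv_mul (hd hF a.1) (hd hG a.2)]
        simp
    exact key.2

/-- The exponential function `x ↦ exp (ξ · (x - a))`. -/
noncomputable def expFun (a : EuclideanSpace ℝ (Fin n)) (ξ : Fin n → ℝ) :
    EuclideanSpace ℝ (Fin n) → ℝ :=
  fun x => Real.exp (∑ i, ξ i * (x i - a i))

variable (a : EuclideanSpace ℝ (Fin n)) (ξ η : Fin n → ℝ)

theorem expFun_self : expFun a ξ a = 1 := by simp [expFun]

theorem expFun_add (x : EuclideanSpace ℝ (Fin n)) :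
    expFun a (ξ + η) x = expFun a ξ x * expFun a η x := by
  simp only [expFun, ← Real.exp_add, ← Finset.sum_add_distrib, Pi.add_apply, add_mul]

theorem contDiff_coord (i : Fin n) :
    ContDiff ℝ ∞ fun x : EuclideanSpace ℝ (Fin n) => x i :=
  (EuclideanSpace.proj (𝕜 := ℝ) i).contDiff

theorem contDiff_expFun : ContDiff ℝ ∞ (expFun a ξ) :=
  Real.contDiff_exp.comp (ContDiff.sum fun i _ =>
    contDiff_const.mul ((contDiff_coord i).sub contDiff_const))

theorem partialDeriv_expFun (i : Fin n) (x : EuclideanSpace ℝ (Fin n)) :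
    partialDeriv i (expFun a ξ) x = ξ i * expFun a ξ x := by
  have h1 : HasFDerivAt (fun x : EuclideanSpace ℝ (Fin n) => ∑ i, ξ i * (x i - a i))
      (∑ i, ξ i • (EuclideanSpace.proj (𝕜 := ℝ) i : EuclideanSpace ℝ (Fin n) →L[ℝ] ℝ)) x :=
    HasFDerivAt.fun_sum fun i _ =>
      (((EuclideanSpace.proj (𝕜 := ℝ) i).hasFDerivAt).sub_const (a i)).const_mul (ξ i)
  have h2 : HasFDerivAt (expFun a ξ) _ x := h1.exp
  rw [partialDeriv, h2.fderiv]
  simp [expFun, mul_comm]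

theorem listDeriv_expFun (l : List (Fin n)) :
    listDeriv l (expFun a ξ) = fun x => (l.map ξ).prod * expFun a ξ x := by
  induction l with
  | nil => simp
  | cons i l ih =>
    funext x
    rw [listDeriv_cons, ih, partialDeriv_const_mul
      ((contDiff_expFun a ξ).differentiable (by simp) x), partialDeriv_expFun]
    simp [mul_assoc, mul_left_comm, mul_comm]

/-- At the base point the exponential turns `∂_J` into the monomial `ξ^J`, so operators become
polynomials. -/
theorem multiPartialDeriv_expFun (J : Fin n → ℕ) :
    multiPartialDeriv J (expFun a ξ) a = ∏ i, ξ i ^ J i := by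
  rw [multiPartialDeriv_eq_listDeriv, listDeriv_expFun]
  simp only [expFun_self, mul_one]
  rw [Finset.prod_list_map_count]
  simp only [count_multiIndexList]
  refine Finset.prod_subset (Finset.subset_univ _) fun i _ hi => ?_
  have : (multiIndexList J).count i = 0 := List.count_eq_zero.2 (by simpa using hi)
  rw [count_multiIndexList] at this
  simp [this]

theorem partialDeriv_comp {φ : EuclideanSpace ℝ (Fin n) → EuclideanSpace ℝ (Fin n)}
    {x : EuclideanSpace ℝ (Fin n)}
    (hF : DifferentiableAt ℝ F (φ x)) (hφ : DifferentiableAt ℝ φ x) (i : Fin n) :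
    partialDeriv i (F ∘ φ) x =
      ∑ j, partialDeriv i (fun y => φ y j) x * partialDeriv j F (φ x) := by
  have h1 (j : Fin n) : partialDeriv i (fun y => φ y j) x =
      (fderiv ℝ φ x (EuclideanSpace.single i 1)) j := by
    have : HasFDerivAt (fun y => φ y j)
        ((EuclideanSpace.proj (𝕜 := ℝ) j : EuclideanSpace ℝ (Fin n) →L[ℝ] ℝ).comp
          (fderiv ℝ φ x)) x :=
      (EuclideanSpace.proj (𝕜 := ℝ) j).hasFDerivAt.comp x hφ.hasFDerivAt
    rw [partialDeriv, this.fderiv]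
    simp
  simp only [h1]
  unfold partialDeriv
  rw [fderiv_comp x hF hφ, ContinuousLinearMap.comp_apply]
  set v := fderiv ℝ φ x (EuclideanSpace.single i 1)
  have hv : v = ∑ j, v j • EuclideanSpace.single j (1 : ℝ) := by
    ext k
    simp [Pi.single_apply]
  conv_lhs => rw [hv]
  simp

/-- The iterated partial derivatives of a composition `F ∘ φ` are linear combinations, with
smooth coefficients independent of `F`, of those of `F`. -/
theorem exists_listDeriv_comp {V : Set (EuclideanSpace ℝ (Fin n))}
    {φ : EuclideanSpace ℝ (Fin n) → EuclideanSpace ℝ (Fin n)} (hU : IsOpen U) (hV : IsOpen V)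
    (hφ : ContDiffOn ℝ ∞ φ U) (hUV : Set.MapsTo φ U V) (l : List (Fin n)) :
    ∃ (ι : Type) (_ : Fintype ι) (L : ι → List (Fin n)) (g : ι → EuclideanSpace ℝ (Fin n) → ℝ),
      (∀ k, (L k).length ≤ l.length) ∧ (∀ k, ContDiffOn ℝ ∞ (g k) U) ∧
      ∀ F : EuclideanSpace ℝ (Fin n) → ℝ, ContDiffOn ℝ ∞ F V → ∀ x ∈ U,
        listDeriv l (F ∘ φ) x = ∑ k, g k x * listDeriv (L k) F (φ x) := by
  induction l with
  | nil => exact ⟨Unit, inferInstance, fun _ => [], fun _ _ => 1, fun _ => le_rfl,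
      fun _ => contDiffOn_const, fun F _ x _ => by simp⟩
  | cons i l ih =>
    obtain ⟨ι, _, L, g, hL, hg, h⟩ := ih
    have hφj (j : Fin n) : ContDiffOn ℝ ∞ (fun y => φ y j) U := (contDiff_coord j).comp_contDiffOn hφ
    -- The new derivative falls on the coefficient (left summand) or, by the chain rule, on the
    -- derivative of `F` in some direction `j` (right summand). Only the second lengthens the list,
    -- which gives the bound on orders.
    refine ⟨ι ⊕ ι × Fin n, inferInstance, Sum.elim L fun k => k.2 :: L k.1,
      Sum.elim (fun k => partialDeriv i (g k))
        fun k x => g k.1 x * partialDeriv i (fun y => φ y k.2) x, ?_, ?_, fun F hF x hx => ?_⟩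
    · rintro (k | k)
      · exact (hL k).trans (Nat.le_succ _)
      · exact Nat.succ_le_succ (hL k.1)
    · rintro (k | k)
      · exact contDiffOn_partialDeriv hU (hg k) i
      · exact (hg k.1).mul (contDiffOn_partialDeriv hU (hφj k.2) i)
    · have hdφ : DifferentiableAt ℝ φ x :=
        (hφ.contDiffAt (hU.mem_nhds hx)).differentiableAt (by simp)
      have hdF (k : ι) : DifferentiableAt ℝ (listDeriv (L k) F) (φ x) :=
        differentiableAt_of_contDiffOn hV (contDiffOn_listDeriv hV hF _) (hUV hx)
      have hdg (k : ι) : DifferentiableAt ℝ (g k) x := differentiableAt_of_contDiffOn hU (hg k) hx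
      have hc (k : ι) : DifferentiableAt ℝ (listDeriv (L k) F ∘ φ) x := (hdF k).comp x hdφ
      have hs := partialDeriv_sum Finset.univ (fun k _ => (hdg k).fun_mul (hc k)) i
      simp only [Function.comp_apply] at hs
      rw [listDeriv_cons, partialDeriv_eqOn hU (h F hF) i hx, hs]
      have step (k : ι) : partialDeriv i (fun y => g k y * listDeriv (L k) F (φ y)) x =
          partialDeriv i (g k) x * listDeriv (L k) F (φ x) +
          ∑ j, g k x * partialDeriv i (fun y => φ y j) x * partialDeriv j (listDeriv (L k) F) (φ x) := by
        have := partialDeriv_mul (hdg k) (hc k) i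
        rw [partialDeriv_comp (hdF k) hdφ] at this
        rw [Finset.mul_sum] at this
        simpa only [mul_assoc, Function.comp_apply] using this
      simp only [step, Finset.sum_add_distrib, Fintype.sum_sum_type, Fintype.sum_prod_type,
        Sum.elim_inl, Sum.elim_inr, listDeriv_cons]

end PartialDerivatives

/-! ### Polynomial cocycles on a vector space -/

section PolynomialCocycles

/-- Over the infinite field `ℝ` a polynomial, here in the `m * n` variables `ξ k i`, is determined
by its values. -/
theorem coeff_eq_zero_of_forall_eval {m n : ℕ} (S : Finset (Fin m → Fin n → ℕ))
    (c : (Fin m → Fin n → ℕ) → ℝ)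
    (h : ∀ ξ : Fin m → Fin n → ℝ, ∑ J ∈ S, c J * ∏ k, ∏ i, ξ k i ^ J k i = 0) :
    ∀ J ∈ S, c J = 0 := by
  classical
  let ε (J : Fin m → Fin n → ℕ) : Fin m × Fin n →₀ ℕ :=
    Finsupp.equivFunOnFinite.symm (Function.uncurry J)
  have hε : Function.Injective ε := fun J J' hJ => by
    have := Finsupp.equivFunOnFinite.symm.injective hJ
    funext k i
    exact congrFun this (k, i)
  let P : MvPolynomial (Fin m × Fin n) ℝ := ∑ J ∈ S, MvPolynomial.monomial (ε J) (c J)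
  have hP : P = 0 := by
    refine MvPolynomial.funext fun x => ?_
    rw [map_zero, map_sum, ← h fun k i => x (k, i)]
    refine Finset.sum_congr rfl fun J _ => ?_
    rw [MvPolynomial.eval_monomial, Finsupp.prod_fintype _ _ (by simp), Fintype.prod_prod_type]
    rfl
  intro J hJ
  have := congrArg (MvPolynomial.coeff (ε J)) hP
  simpa [P, MvPolynomial.coeff_sum, MvPolynomial.coeff_monomial, hε.eq_iff, hJ] using this

/-- Take the cocycle identity at `(x, y, z)`, subtract it at `(x, z, y)` and add it at `(z, x, y)`:
everything but the antisymmetrized terms cancels. -/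
theorem antisymm_add_left_of_cocycle {V : Type*} [AddCommGroup V] {s : V → V → ℝ}
    (hs : ∀ x y z, s y z - s (x + y) z + s x (y + z) - s x y = 0) (x y z : V) :
    s (x + y) z - s z (x + y) = (s x z - s z x) + (s y z - s z y) := by
  have h1 := hs x y z
  have h2 := hs x z y
  have h3 := hs z x y
  rw [add_comm z y] at h2
  rw [add_comm z x] at h3
  linarith

/-- The antisymmetrization of a continuous cocycle is bilinear. -/
theorem antisymm_eq_sum_of_cocycle {n : ℕ} {s : (Fin n → ℝ) → (Fin n → ℝ) → ℝ}
    (hs : ∀ x y z, s y z - s (x + y) z + s x (y + z) - s x y = 0)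
    (hc : Continuous (Function.uncurry s)) (x y : Fin n → ℝ) :
    s x y - s y x = ∑ i, ∑ j, x i * y j *
      (s (Pi.single i 1) (Pi.single j 1) - s (Pi.single j 1) (Pi.single i 1)) := by
  have hadd := antisymm_add_left_of_cocycle hs
  have hlin (z x : Fin n → ℝ) :
      s x z - s z x = ∑ i, x i * (s (Pi.single i 1) z - s z (Pi.single i 1)) := by
    -- A continuous additive map is real linear, hence determined by its values on the unit vectors.
    let φ : (Fin n → ℝ) →+ ℝ := AddMonoidHom.mk' (fun x => s x z - s z x) fun x y => hadd x y z
    have hφ : Continuous φ :=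
      (hc.comp (continuous_id.prodMk continuous_const)).sub
        (hc.comp (continuous_const.prodMk continuous_id))
    have := LinearMap.pi_apply_eq_sum_univ (φ.toRealLinearMap hφ).toLinearMap x
    have hsingle (i : Fin n) : (fun j => if i = j then (1 : ℝ) else 0) = Pi.single i 1 := by
      funext j
      simp [Pi.single_apply, eq_comm]
    simp only [hsingle] at this
    exact this
  rw [hlin y x]
  refine Finset.sum_congr rfl fun i _ => ?_
  rw [← neg_sub, hlin, ← Finset.sum_neg_distrib, Finset.mul_sum]
  refine Finset.sum_congr rfl fun j _ => by ring

/-- A symmetric differentiable cocycle is the coboundary of any function whose radial derivative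
is the derivative of the cocycle along the first factor. -/
theorem coboundary_of_symm_cocycle {V : Type*} [NormedAddCommGroup V] [NormedSpace ℝ V]
    {s : V × V → ℝ} {t : V → ℝ}
    (hs : ∀ x y z, s (y, z) - s (x + y, z) + s (x, y + z) - s (x, y) = 0)
    (hsymm : ∀ x y, s (x, y) = s (y, x)) (hd : Differentiable ℝ s)
    (ht : ∀ (x : V) (u : ℝ),
      HasDerivAt (fun u : ℝ => t (u • x)) (fderiv ℝ s (0, u • x) (x, 0)) u) (x y : V) :
    s (x, y) - s (0, 0) = t (x + y) - t x - t y + t 0 := by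
  have hline (p q : V × V) : HasDerivAt (fun h : ℝ => s (p + h • q)) (fderiv ℝ s p q) 0 := by
    have h1 : HasDerivAt (fun h : ℝ => p + h • q) q 0 := by
      simpa using ((hasDerivAt_id (0 : ℝ)).smul_const q).const_add p
    have h2 : HasFDerivAt s (fderiv ℝ s p) (p + (0 : ℝ) • q) := by
      simpa using (hd p).hasFDerivAt
    exact h2.comp_hasDerivAt 0 h1
  -- Differentiate the cocycle identity at `(h • v, x, y)` at `h = 0`: the first partial derivative
  -- anywhere reduces to its values on `{0} × V`.
  have hleft (v x y : V) : fderiv ℝ s (x, y) (v, 0) =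
      fderiv ℝ s (0, x + y) (v, 0) - fderiv ℝ s (0, x) (v, 0) := by
    refine (hline (x, y) (v, 0)).unique ?_
    have h1 := ((hline (0, x + y) (v, 0)).sub (hline (0, x) (v, 0))).add_const (s (x, y))
    refine h1.congr_of_eventuallyEq (Filter.Eventually.of_forall fun h => ?_)
    have := hs (h • v) x y
    simp only [Prod.smul_mk, Prod.mk_add_mk, smul_zero, add_zero, zero_add, Pi.sub_apply]
    rw [add_comm x (h • v)]
    linarith
  have hright (v x y : V) : fderiv ℝ s (x, y) (0, v) = fderiv ℝ s (y, x) (v, 0) := by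
    refine (hline (x, y) (0, v)).unique ?_
    refine (hline (y, x) (v, 0)).congr_of_eventuallyEq (Filter.Eventually.of_forall fun h => ?_)
    simp only [Prod.smul_mk, Prod.mk_add_mk, smul_zero, add_zero]
    exact hsymm _ _
  -- By `hleft` and `hright` the derivative of `s` along the ray consists of radial derivatives of
  -- `t`, so the difference is constant; comparing `u = 1` with `u = 0` gives the claim.
  have hray (u : ℝ) : HasDerivAt (fun u : ℝ => s (u • x, u • y) - t (u • (x + y)) + t (u • x)
      + t (u • y)) 0 u := by
    have h1 : HasDerivAt (fun u : ℝ => s (u • x, u • y)) (fderiv ℝ s (u • x, u • y) (x, y)) u := by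
      have h2 : HasDerivAt (fun u : ℝ => (u • x, u • y)) (x, y) u := by
        simpa using ((hasDerivAt_id u).smul_const x).prodMk ((hasDerivAt_id u).smul_const y)
      exact (hd _).hasFDerivAt.comp_hasDerivAt u h2
    refine (((h1.sub (ht (x + y) u)).add (ht x u)).add (ht y u)).congr_deriv ?_
    have e1 : ((x, y) : V × V) = (x, 0) + (0, y) := by simp
    have e2 : ((x + y, 0) : V × V) = (x, 0) + (y, 0) := by simp
    rw [e1, e2, map_add, map_add, hright, hleft, hleft y, smul_add, add_comm (u • y) (u • x)]
    ring
  have := is_const_of_deriv_eq_zero (fun u => (hray u).differentiableAt)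
    (fun u => (hray u).deriv) 1 0
  simp only [one_smul, zero_smul] at this
  linarith

end PolynomialCocycles

/-! ### Iterated partial derivatives in the charts of a manifold -/

section ChartDerivatives

variable {n : ℕ} {M : Type*} [TopologicalSpace M]

/-- The iterated partial derivative `∂_J f` in the coordinates of the chart `e`. -/
noncomputable def chartDeriv (e : OpenPartialHomeomorph M (EuclideanSpace ℝ (Fin n)))
    (J : Fin n → ℕ) (f : M → ℝ) (p : M) : ℝ :=
  multiPartialDeriv J (f ∘ e.symm) (e p)

variable {e e' : OpenPartialHomeomorph M (EuclideanSpace ℝ (Fin n))} {p : M}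

theorem multiPartialDeriv_zero (F : EuclideanSpace ℝ (Fin n) → ℝ) :
    multiPartialDeriv 0 F = F := by
  rw [multiPartialDeriv_eq_listDeriv]
  have : multiIndexList (0 : Fin n → ℕ) = [] := by
    rw [← List.length_eq_zero_iff, length_multiIndexList]
    simp
  rw [this, listDeriv_nil]

theorem multiPartialDeriv_single (i : Fin n) (F : EuclideanSpace ℝ (Fin n) → ℝ) :
    multiPartialDeriv (Pi.single i 1) F = partialDeriv i F := by
  rw [multiPartialDeriv_eq_listDeriv]
  have : multiIndexList (Pi.single i 1 : Fin n → ℕ) = [i] := by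
    refine List.perm_singleton.1 (List.perm_iff_count.2 fun j => ?_)
    rw [count_multiIndexList, List.count_singleton, Pi.single_apply]
    by_cases h : j = i
    · simp [h]
    · simp [h, Ne.symm h]
  rw [this, listDeriv_cons, listDeriv_nil]

theorem chartDeriv_zero (hp : p ∈ e.source) (f : M → ℝ) : chartDeriv e 0 f p = f p := by
  rw [chartDeriv, multiPartialDeriv_zero, Function.comp_apply, e.left_inv hp]

theorem multiPartialDeriv_congr_of_eventuallyEq {F G : EuclideanSpace ℝ (Fin n) → ℝ}
    {x : EuclideanSpace ℝ (Fin n)} (h : F =ᶠ[nhds x] G) (J : Fin n → ℕ) :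
    multiPartialDeriv J F x = multiPartialDeriv J G x := by
  obtain ⟨U, hU, hUo, hx⟩ := eventually_nhds_iff.1 h
  simp only [multiPartialDeriv_eq_listDeriv]
  exact listDeriv_eqOn hUo (fun y hy => hU y hy) _ hx

section Smooth

variable [ChartedSpace (EuclideanSpace ℝ (Fin n)) M]

theorem contDiffOn_comp_symm (he : e ∈ IsManifold.maximalAtlas (𝓡 n) ∞ M) (f : SmoothFun n M) :
    ContDiffOn ℝ ∞ (f ∘ e.symm) e.target :=
  contMDiffOn_iff_contDiffOn.1
    (f.contMDiff.comp_contMDiffOn (contMDiffOn_symm_of_mem_maximalAtlas he))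

theorem contMDiffOn_comp_chart (he : e ∈ IsManifold.maximalAtlas (𝓡 n) ∞ M)
    {F : EuclideanSpace ℝ (Fin n) → ℝ} {U : Set (EuclideanSpace ℝ (Fin n))}
    (hF : ContDiffOn ℝ ∞ F U) :
    ContMDiffOn (𝓡 n) 𝓘(ℝ, ℝ) ∞ (fun p => F (e p)) (e.source ∩ e ⁻¹' U) :=
  (contMDiffOn_iff_contDiffOn.2 hF).comp
    ((contMDiffOn_of_mem_maximalAtlas he).mono Set.inter_subset_left) Set.inter_subset_right

theorem contDiffOn_multiPartialDeriv {U : Set (EuclideanSpace ℝ (Fin n))} (hU : IsOpen U)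
    {F : EuclideanSpace ℝ (Fin n) → ℝ} (hF : ContDiffOn ℝ ∞ F U) (J : Fin n → ℕ) :
    ContDiffOn ℝ ∞ (multiPartialDeriv J F) U := by
  rw [multiPartialDeriv_eq_listDeriv]
  exact contDiffOn_listDeriv hU hF _

theorem contMDiffOn_chartDeriv (he : e ∈ IsManifold.maximalAtlas (𝓡 n) ∞ M) (J : Fin n → ℕ)
    (f : SmoothFun n M) :
    ContMDiffOn (𝓡 n) 𝓘(ℝ, ℝ) ∞ (chartDeriv e J f) e.source :=
  (contMDiffOn_comp_chart he
    (contDiffOn_multiPartialDeriv e.open_target (contDiffOn_comp_symm he f) J)).mono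
      fun _ hp => ⟨hp, e.map_source hp⟩

theorem chartDeriv_add (he : e ∈ IsManifold.maximalAtlas (𝓡 n) ∞ M) (hp : p ∈ e.source)
    (J : Fin n → ℕ) (f g : SmoothFun n M) :
    chartDeriv e J (f + g : SmoothFun n M) p = chartDeriv e J f p + chartDeriv e J g p := by
  simp only [chartDeriv, multiPartialDeriv_eq_listDeriv]
  exact listDeriv_add e.open_target (contDiffOn_comp_symm he f) (contDiffOn_comp_symm he g) _
    (e.map_source hp)

theorem chartDeriv_smul (he : e ∈ IsManifold.maximalAtlas (𝓡 n) ∞ M) (hp : p ∈ e.source)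
    (J : Fin n → ℕ) (c : ℝ) (f : SmoothFun n M) :
    chartDeriv e J (c • f : SmoothFun n M) p = c * chartDeriv e J f p := by
  simp only [chartDeriv, multiPartialDeriv_eq_listDeriv]
  exact listDeriv_const_mul e.open_target (contDiffOn_comp_symm he f) c _ (e.map_source hp)

/-- The tuples of indices bounded by `r`. -/
def boundedMultiIndices (n r : ℕ) : Finset (Fin n → ℕ) :=
  Fintype.piFinset fun _ => Finset.range (r + 1)

/-- Change of charts for iterated partial derivatives. -/
theorem exists_chartDeriv_eq_sum (he : e ∈ IsManifold.maximalAtlas (𝓡 n) ∞ M)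
    (he' : e' ∈ IsManifold.maximalAtlas (𝓡 n) ∞ M) {J : Fin n → ℕ} {r : ℕ} (hJ : ∑ i, J i ≤ r) :
    ∃ C : (Fin n → ℕ) → M → ℝ,
      (∀ K, ContMDiffOn (𝓡 n) 𝓘(ℝ, ℝ) ∞ (C K) (e.source ∩ e'.source)) ∧
      ∀ f : SmoothFun n M, ∀ p ∈ e.source ∩ e'.source,
        chartDeriv e J f p = ∑ K ∈ boundedMultiIndices n r, C K p * chartDeriv e' K f p := by
  classical
  let U := (e.symm.trans e').source
  have hUo : IsOpen U := (e.symm.trans e').open_source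
  have hU {y} (hy : y ∈ U) : y ∈ e.target ∧ e.symm y ∈ e'.source := by
    simpa [U, OpenPartialHomeomorph.trans_source] using hy
  have hφ : ContDiffOn ℝ ∞ (e' ∘ e.symm) U :=
    contMDiffOn_iff_contDiffOn.1 ((contMDiffOn_of_mem_maximalAtlas he').comp
      ((contMDiffOn_symm_of_mem_maximalAtlas he).mono fun y hy => (hU hy).1) fun y hy => (hU hy).2)
  obtain ⟨ι, _, L, g, hL, hg, h⟩ := exists_listDeriv_comp hUo e'.open_target hφ
    (fun y hy => e'.map_source (hU hy).2) (multiIndexList J)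
  rw [length_multiIndexList] at hL
  have hW {p} (hp : p ∈ e.source ∩ e'.source) : e p ∈ U := by
    simpa [U, OpenPartialHomeomorph.trans_source, hp.1] using hp.2
  -- Different lists may have the same multi-index, so the coefficient at `K` collects all of them.
  refine ⟨fun K p => ∑ k, if (fun i => (L k).count i) = K then g k (e p) else 0, fun K => ?_,
    fun f p hp => ?_⟩
  · refine contMDiffOn_finsetSum fun k _ => ?_
    split_ifs
    · exact (contMDiffOn_comp_chart he (hg k)).mono fun p hp => ⟨hp.1, hW hp⟩
    · exact contMDiffOn_const
  · have hfe : Set.EqOn (f ∘ e.symm) ((f ∘ e'.symm) ∘ (e' ∘ e.symm)) U := fun y hy => by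
      simp [e'.left_inv (hU hy).2]
    rw [chartDeriv, multiPartialDeriv_eq_listDeriv, listDeriv_eqOn hUo hfe _ (hW hp),
      h _ (contDiffOn_comp_symm he' f) _ (hW hp)]
    simp only [Finset.sum_mul]
    rw [Finset.sum_comm]
    refine Finset.sum_congr rfl fun k _ => ?_
    have hmem : (fun i => (L k).count i) ∈ boundedMultiIndices n r :=
      Fintype.mem_piFinset.2 fun i => Finset.mem_range.2
        (Nat.lt_succ_of_le (List.count_le_length.trans ((hL k).trans hJ)))
    simp only [ite_mul, zero_mul, Finset.sum_ite_eq, hmem, if_true]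
    rw [chartDeriv, Function.comp_apply, e.left_inv hp.1,
      listDeriv_eq_multiPartialDeriv e'.open_target (contDiffOn_comp_symm he' f) _
        (e'.map_source hp.2)]

/-- Every smooth function of the coordinates at `p` is near `p` equal to a global smooth
function. -/
theorem exists_smoothFun_eventuallyEq [T2Space M] [IsManifold (𝓡 n) ∞ M]
    (he : e ∈ IsManifold.maximalAtlas (𝓡 n) ∞ M)
    (hp : p ∈ e.source) {F : EuclideanSpace ℝ (Fin n) → ℝ} (hF : ContDiff ℝ ∞ F) :
    ∃ f : SmoothFun n M, f ∘ e.symm =ᶠ[nhds (e p)] F := by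
  -- The cutoff has closed support inside the chart domain, so the irrelevant values of `F ∘ e`
  -- outside it are killed smoothly.
  obtain ⟨ψ, -, hψ⟩ := (SmoothBumpFunction.nhds_basis_tsupport (I := 𝓡 n) p).mem_iff.1
    (e.open_source.mem_nhds hp)
  have hsmooth : ContMDiff (𝓡 n) 𝓘(ℝ, ℝ) ∞ fun x => ψ x • F (e x) := by
    refine contMDiff_of_tsupport fun x hx => ?_
    have hx' : x ∈ e.source := hψ (tsupport_smul_subset_left _ _ hx)
    refine ψ.contMDiffAt.smul ?_
    exact hF.contMDiff.contMDiffAt.comp x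
      ((contMDiffOn_of_mem_maximalAtlas he).contMDiffAt (e.open_source.mem_nhds hx'))
  refine ⟨⟨_, hsmooth⟩, ?_⟩
  have h1 : ∀ᶠ y in nhds (e p), ψ (e.symm y) = 1 := by
    have : Filter.Tendsto e.symm (nhds (e p)) (nhds p) := by
      have := e.continuousAt_symm (e.map_source hp)
      rwa [ContinuousAt, e.left_inv hp] at this
    exact this.eventually ψ.eventuallyEq_one
  filter_upwards [h1, e.open_target.mem_nhds (e.map_source hp)] with y hy hy'
  change ψ (e.symm y) • F (e (e.symm y)) = F y
  rw [hy, one_smul, e.right_inv hy']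

end Smooth

/-! ### Functionals of finite order at a point -/

variable [ChartedSpace (EuclideanSpace ℝ (Fin n)) M]

variable (e p) in
/-- The functionals `(f₀, …, f_{m-1}) ↦ ∑ c_J ∂_{J 0} f₀ (p) ⋯ ∂_{J (m-1)} f_{m-1} (p)`. -/
def jetFunctionals (m : ℕ) : Submodule ℝ ((Fin m → SmoothFun n M) → ℝ) :=
  Submodule.span ℝ (Set.range fun (J : Fin m → Fin n → ℕ) f => ∏ k, chartDeriv e (J k) (f k) p)

theorem prod_chartDeriv_mem_jetFunctionals {m : ℕ} (J : Fin m → Fin n → ℕ) :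
    (fun f : Fin m → SmoothFun n M => ∏ k, chartDeriv e (J k) (f k) p) ∈ jetFunctionals e p m :=
  Submodule.subset_span ⟨J, rfl⟩

theorem chartDeriv_of_eventuallyEq_expFun {ξ : Fin n → ℝ} {f : SmoothFun n M}
    (hf : f ∘ e.symm =ᶠ[nhds (e p)] expFun (e p) ξ) (J : Fin n → ℕ) :
    chartDeriv e J f p = ∏ i, ξ i ^ J i := by
  rw [chartDeriv, multiPartialDeriv_congr_of_eventuallyEq hf, multiPartialDeriv_expFun]

theorem apply_of_eventuallyEq_expFun (hp : p ∈ e.source) {ξ : Fin n → ℝ} {f : SmoothFun n M}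
    (hf : f ∘ e.symm =ᶠ[nhds (e p)] expFun (e p) ξ) : f p = 1 := by
  rw [← chartDeriv_zero hp f, chartDeriv_of_eventuallyEq_expFun hf]
  simp

theorem mul_eventuallyEq_expFun {ξ η : Fin n → ℝ} {f g : SmoothFun n M}
    (hf : f ∘ e.symm =ᶠ[nhds (e p)] expFun (e p) ξ)
    (hg : g ∘ e.symm =ᶠ[nhds (e p)] expFun (e p) η) :
    (f * g : SmoothFun n M) ∘ e.symm =ᶠ[nhds (e p)] expFun (e p) (ξ + η) := by
  filter_upwards [hf, hg] with y hy hy'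
  rw [expFun_add, ← hy, ← hy']
  rfl

/-- A functional of finite order vanishing on exponentials vanishes. -/
theorem eq_zero_of_mem_jetFunctionals [T2Space M] [IsManifold (𝓡 n) ∞ M]
    (he : e ∈ IsManifold.maximalAtlas (𝓡 n) ∞ M) (hp : p ∈ e.source) {m : ℕ}
    {L : (Fin m → SmoothFun n M) → ℝ} (hL : L ∈ jetFunctionals e p m)
    (h : ∀ (ξ : Fin m → Fin n → ℝ) (f : Fin m → SmoothFun n M),
      (∀ k, f k ∘ e.symm =ᶠ[nhds (e p)] expFun (e p) (ξ k)) → L f = 0) : L = 0 := by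
  obtain ⟨c, rfl⟩ := Finsupp.mem_span_range_iff_exists_finsupp.1 hL
  -- Evaluated on exponentials, the functional is the polynomial in `ξ` with coefficients `c J`.
  have hc : ∀ J ∈ c.support, c J = 0 := by
    refine coeff_eq_zero_of_forall_eval _ _ fun ξ => ?_
    choose f hf using fun k =>
      exists_smoothFun_eventuallyEq he hp (contDiff_expFun (e p) (ξ k))
    rw [← h ξ f hf, Finsupp.sum, Finset.sum_apply]
    refine Finset.sum_congr rfl fun J _ => ?_
    rw [Pi.smul_apply, smul_eq_mul]
    congr 1
    exact Finset.prod_congr rfl fun k _ => (chartDeriv_of_eventuallyEq_expFun (hf k) _).symm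
  exact Finset.sum_eq_zero fun J hJ => by simp [hc J hJ]

/-- By the Leibniz rule, precomposing with the product keeps the order finite; thus `T(f g)` can
also be tested on exponentials. -/
theorem chartDeriv_mul_mem_jetFunctionals (he : e ∈ IsManifold.maximalAtlas (𝓡 n) ∞ M)
    (hp : p ∈ e.source) (J : Fin n → ℕ) :
    (fun f : Fin 2 → SmoothFun n M => chartDeriv e J (f 0 * f 1 : SmoothFun n M) p) ∈
      jetFunctionals e p 2 := by
  obtain ⟨L, hL⟩ := exists_listDeriv_mul (multiIndexList J)
  have : (fun f : Fin 2 → SmoothFun n M => chartDeriv e J (f 0 * f 1 : SmoothFun n M) p) =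
      (L.map fun a => fun f : Fin 2 → SmoothFun n M =>
        ∏ k, chartDeriv e (![fun i => a.1.count i, fun i => a.2.count i] k) (f k) p).sum := by
    funext f
    have h0 := contDiffOn_comp_symm he (f 0)
    have h1 := contDiffOn_comp_symm he (f 1)
    rw [chartDeriv, multiPartialDeriv_eq_listDeriv]
    refine (hL e.open_target h0 h1 (e.map_source hp)).trans ?_
    clear hL
    induction L with
    | nil => rfl
    | cons a L ih =>
      simp only [List.map_cons, List.sum_cons, Pi.add_apply] at ih ⊢
      rw [← ih]
      simp [Fin.prod_univ_two, chartDeriv,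
        listDeriv_eq_multiPartialDeriv e.open_target h0 _ (e.map_source hp),
        listDeriv_eq_multiPartialDeriv e.open_target h1 _ (e.map_source hp)]
  rw [this]
  refine list_sum_mem fun x hx => ?_
  obtain ⟨a, -, rfl⟩ := List.mem_map.1 hx
  exact prod_chartDeriv_mem_jetFunctionals _

end ChartDerivatives

/-! ### The cochain of a bivector field -/

namespace HochschildCochain

variable {K A : Type*} [CommRing K] [CommRing A] [Algebra K A]

theorem differential_one_apply (φ : HochschildCochain K A 1) (f : Fin 2 → A) :
    differential K A 1 φ f = φ ![f 0 * f 1] - f 0 * φ ![f 1] - φ ![f 0] * f 1 := by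
  have h1 : Fin.contractNth (Fin.castSucc (0 : Fin 1)) (· * ·) f = ![f 0 * f 1] := by
    funext i; fin_cases i; rfl
  have h2 : Fin.tail f = ![f 1] := by funext i; fin_cases i; rfl
  have h3 : Fin.init f = ![f 0] := by funext i; fin_cases i; rfl
  change (-1 : A) ^ 1 * ((∑ i : Fin 1, (-1 : A) ^ ((i : ℕ) + 1) • φ.contract i) f
    + f 0 * φ (Fin.tail f) + (-1 : A) ^ 2 * (φ (Fin.init f) * f 1)) = _
  have h4 : (∑ i : Fin 1, (-1 : A) ^ ((i : ℕ) + 1) • φ.contract i) f = - φ ![f 0 * f 1] := by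
    rw [Fin.sum_univ_one, smul_apply, ← h1]
    change (-1 : A) ^ (0 + 1) * φ _ = _
    ring
  rw [h4, h2, h3]
  ring

theorem differential_two_apply (φ : HochschildCochain K A 2) (f : Fin 3 → A) :
    differential K A 2 φ f = f 0 * φ ![f 1, f 2] - φ ![f 0 * f 1, f 2] + φ ![f 0, f 1 * f 2]
      - φ ![f 0, f 1] * f 2 := by
  have h0 : Fin.contractNth (Fin.castSucc (0 : Fin 2)) (· * ·) f = ![f 0 * f 1, f 2] := by
    funext i; fin_cases i <;> rfl
  have h1 : Fin.contractNth (Fin.castSucc (1 : Fin 2)) (· * ·) f = ![f 0, f 1 * f 2] := by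
    funext i; fin_cases i <;> rfl
  have h2 : Fin.tail f = ![f 1, f 2] := by funext i; fin_cases i <;> rfl
  have h3 : Fin.init f = ![f 0, f 1] := by funext i; fin_cases i <;> rfl
  change (-1 : A) ^ 2 * ((∑ i : Fin 2, (-1 : A) ^ ((i : ℕ) + 1) • φ.contract i) f
    + f 0 * φ (Fin.tail f) + (-1 : A) ^ 3 * (φ (Fin.init f) * f 2)) = _
  have h4 : (∑ i : Fin 2, (-1 : A) ^ ((i : ℕ) + 1) • φ.contract i) f =
      - φ ![f 0 * f 1, f 2] + φ ![f 0, f 1 * f 2] := by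
    rw [Fin.sum_univ_two, add_apply, smul_apply, smul_apply, ← h0, ← h1]
    change (-1 : A) ^ (0 + 1) * φ _ + (-1 : A) ^ (1 + 1) * φ _ = _
    ring
  rw [h4, h2, h3]
  ring

end HochschildCochain

section Bivector

variable {n : ℕ} {M : Type*} [TopologicalSpace M] [ChartedSpace (EuclideanSpace ℝ (Fin n)) M]
  {e : OpenPartialHomeomorph M (EuclideanSpace ℝ (Fin n))} {p : M}

/-- Terms with the same tuple are merged into one coefficient, so local formulas may repeat tuples.
The set `S` still has to serve all charts at once. -/
theorem isMultidifferentialOperator_of_sum {m : ℕ} {D : HochschildCochain ℝ (SmoothFun n M) m}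
    (S : Finset (Fin m → Fin n → ℕ))
    (h : ∀ e ∈ IsManifold.maximalAtlas (𝓡 n) ∞ M,
      ∃ (ι : Type) (_ : Fintype ι) (L : ι → Fin m → Fin n → ℕ) (g : ι → M → ℝ),
        (∀ k, L k ∈ S) ∧ (∀ k, ContMDiffOn (𝓡 n) 𝓘(ℝ, ℝ) ∞ (g k) e.source) ∧
        ∀ f, ∀ p ∈ e.source, D f p = ∑ k, g k p * ∏ j, chartDeriv e (L k j) (f j) p) :
    IsMultidifferentialOperator D := by
  classical
  refine ⟨S, fun e he => ?_⟩
  obtain ⟨ι, _, L, g, hL, hg, hD⟩ := h e he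
  refine ⟨fun J p => ∑ k, if L k = J then g k p else 0, fun J => ?_, fun f p hp => ?_⟩
  · refine contMDiffOn_finsetSum fun k _ => ?_
    split_ifs
    exacts [hg k, contMDiffOn_const]
  · rw [hD f p hp]
    simp only [Finset.sum_mul]
    rw [Finset.sum_comm]
    refine Finset.sum_congr rfl fun k _ => ?_
    simp only [ite_mul, zero_mul, Finset.sum_ite_eq, hL k, if_true]
    rfl

theorem chartDeriv_single_mul (he : e ∈ IsManifold.maximalAtlas (𝓡 n) ∞ M) (hp : p ∈ e.source)
    (i : Fin n) (f g : SmoothFun n M) :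
    chartDeriv e (Pi.single i 1) (f * g : SmoothFun n M) p =
      chartDeriv e (Pi.single i 1) f p * g p + f p * chartDeriv e (Pi.single i 1) g p := by
  have hd (f : SmoothFun n M) : DifferentiableAt ℝ (f ∘ e.symm) (e p) :=
    differentiableAt_of_contDiffOn e.open_target (contDiffOn_comp_symm he f) (e.map_source hp)
  have := partialDeriv_mul (hd f) (hd g) i
  simp only [chartDeriv, multiPartialDeriv_single]
  simp only [Function.comp_apply, e.left_inv hp] at this
  exact this

theorem differentialAt_add (f g : SmoothFun n M) (p : M) :
    differentialAt (f + g) p = differentialAt f p + differentialAt g p := by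
  have hd (f : SmoothFun n M) : MDifferentiableAt (𝓡 n) 𝓘(ℝ, ℝ) f p :=
    f.contMDiff.mdifferentiableAt (by simp)
  have := mfderiv_add (hd f) (hd g)
  refine LinearMap.ext fun v => DFunLike.congr_fun this v

theorem differentialAt_smul (c : ℝ) (f : SmoothFun n M) (p : M) :
    differentialAt (c • f) p = c • differentialAt f p := by
  have := const_smul_mfderiv (f.contMDiff.mdifferentiableAt (by simp) :
    MDifferentiableAt (𝓡 n) 𝓘(ℝ, ℝ) f p) c
  refine LinearMap.ext fun v => DFunLike.congr_fun this v

theorem differentialAt_update {k : ℕ} (f : Fin k → SmoothFun n M) (j : Fin k) (x : SmoothFun n M)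
    (p : M) : (fun i => differentialAt (Function.update f j x i) p) =
      Function.update (fun i => differentialAt (f i) p) j (differentialAt x p) :=
  funext fun i => Function.apply_update (fun _ g => differentialAt g p) f j x i

theorem pairingDual_update_add {V : Type*} [AddCommGroup V] [Module ℝ V] {k : ℕ} (w : ⋀[ℝ]^k V)
    (v : Fin k → Module.Dual ℝ V) (j : Fin k) (x y : Module.Dual ℝ V) :
    exteriorPower.pairingDual ℝ V k (exteriorPower.ιMulti ℝ k (Function.update v j (x + y))) w =
      exteriorPower.pairingDual ℝ V k (exteriorPower.ιMulti ℝ k (Function.update v j x)) w +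
      exteriorPower.pairingDual ℝ V k (exteriorPower.ιMulti ℝ k (Function.update v j y)) w := by
  rw [AlternatingMap.map_update_add, map_add, LinearMap.add_apply]

theorem pairingDual_update_smul {V : Type*} [AddCommGroup V] [Module ℝ V] {k : ℕ} (w : ⋀[ℝ]^k V)
    (v : Fin k → Module.Dual ℝ V) (j : Fin k) (c : ℝ) (x : Module.Dual ℝ V) :
    exteriorPower.pairingDual ℝ V k (exteriorPower.ιMulti ℝ k (Function.update v j (c • x))) w =
      c * exteriorPower.pairingDual ℝ V k (exteriorPower.ιMulti ℝ k (Function.update v j x)) w := by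
  rw [AlternatingMap.map_update_smul, map_smul, LinearMap.smul_apply, smul_eq_mul]

theorem hkrValue_update {k : ℕ} (α : MultivectorField n M k) (f : Fin k → SmoothFun n M)
    (j : Fin k) (x : SmoothFun n M) (p : M) :
    hkrValue α (Function.update f j x) p = (1 / (k.factorial : ℝ)) *
      exteriorPower.pairingDual ℝ (TangentSpace (𝓡 n) p) k (exteriorPower.ιMulti ℝ k
        (Function.update (fun i => differentialAt (f i) p) j (differentialAt x p))) (α.toFun p) :=
  congrArg (fun v => (1 / (k.factorial : ℝ)) *
    exteriorPower.pairingDual ℝ (TangentSpace (𝓡 n) p) k (exteriorPower.ιMulti ℝ k v) (α.toFun p))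
    (differentialAt_update f j x p)

theorem hkrValue_update_add {k : ℕ} (α : MultivectorField n M k) (f : Fin k → SmoothFun n M)
    (j : Fin k) (x y : SmoothFun n M) (p : M) :
    hkrValue α (Function.update f j (x + y)) p =
      hkrValue α (Function.update f j x) p + hkrValue α (Function.update f j y) p := by
  rw [hkrValue_update α f j (x + y), hkrValue_update α f j x, hkrValue_update α f j y,
    differentialAt_add, pairingDual_update_add, mul_add]

theorem hkrValue_update_smul {k : ℕ} (α : MultivectorField n M k) (f : Fin k → SmoothFun n M)
    (j : Fin k) (c : ℝ) (x : SmoothFun n M) (p : M) :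
    hkrValue α (Function.update f j (c • x)) p = c * hkrValue α (Function.update f j x) p := by
  rw [hkrValue_update α f j (c • x), hkrValue_update α f j x, differentialAt_smul,
    pairingDual_update_smul, mul_left_comm]

theorem differentialAt_comp_mfderiv_symm (he : e ∈ IsManifold.maximalAtlas (𝓡 n) ∞ M)
    (hp : p ∈ e.source) (f : SmoothFun n M) (v : EuclideanSpace ℝ (Fin n)) :
    differentialAt f p (mfderiv (𝓡 n) (𝓡 n) e.symm (e p) v) = fderiv ℝ (f ∘ e.symm) (e p) v := by
  have hp' := e.map_source hp
  have hs : MDifferentiableAt (𝓡 n) (𝓡 n) e.symm (e p) :=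
    ((contMDiffOn_symm_of_mem_maximalAtlas he).contMDiffAt
      (e.open_target.mem_nhds hp')).mdifferentiableAt (by simp)
  have hf : MDifferentiableAt (𝓡 n) 𝓘(ℝ, ℝ) f (e.symm (e p)) :=
    f.contMDiff.mdifferentiableAt (by simp)
  have h := mfderiv_comp (e p) hf hs
  rw [mfderiv_eq_fderiv] at h
  -- The points `e.symm (e p)` and `p` agree only propositionally, so their tangent spaces are
  -- compared through the model space.
  have hq : ∀ q, q = p → (mfderiv (𝓡 n) 𝓘(ℝ, ℝ) f q : EuclideanSpace ℝ (Fin n) →L[ℝ] ℝ) =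
      mfderiv (𝓡 n) 𝓘(ℝ, ℝ) f p := by
    rintro _ rfl
    rfl
  have h' := DFunLike.congr_fun h v
  refine Eq.trans ?_ h'.symm
  exact (DFunLike.congr_fun (hq (e.symm (e p)) (e.left_inv hp))
    (mfderiv (𝓡 n) (𝓡 n) e.symm (e p) v : EuclideanSpace ℝ (Fin n))).symm

theorem differentialAt_coordVector (he : e ∈ IsManifold.maximalAtlas (𝓡 n) ∞ M)
    (hp : p ∈ e.source) (f : SmoothFun n M) (i : Fin n) :
    differentialAt f p (coordVector e i p) = chartDeriv e (Pi.single i 1) f p := by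
  rw [coordVector, differentialAt_comp_mfderiv_symm he hp, chartDeriv, multiPartialDeriv_single]
  rfl

theorem pairingDual_sum_coordVector (he : e ∈ IsManifold.maximalAtlas (𝓡 n) ∞ M)
    (hp : p ∈ e.source) (a : (Fin 2 → Fin n) → ℝ) (f : Fin 2 → SmoothFun n M) :
    exteriorPower.pairingDual ℝ (TangentSpace (𝓡 n) p) 2
      (exteriorPower.ιMulti ℝ 2 (fun j => differentialAt (f j) p))
      (∑ s, a s • exteriorPower.ιMulti ℝ 2 (fun j => coordVector e (s j) p)) =
    ∑ s, a s * (chartDeriv e (Pi.single (s 0) 1) (f 0) p * chartDeriv e (Pi.single (s 1) 1) (f 1) p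
      - chartDeriv e (Pi.single (s 0) 1) (f 1) p * chartDeriv e (Pi.single (s 1) 1) (f 0) p) := by
  rw [map_sum]
  refine Finset.sum_congr rfl fun s _ => ?_
  rw [map_smul, exteriorPower.pairingDual_ιMulti_ιMulti, Matrix.det_fin_two]
  simp only [Matrix.of_apply, differentialAt_coordVector he hp, smul_eq_mul]

theorem hkrValue_eq_sum (he : e ∈ IsManifold.maximalAtlas (𝓡 n) ∞ M)
    (hp : p ∈ e.source) (α : MultivectorField n M 2) (a : (Fin 2 → Fin n) → ℝ)
    (ha : α.toFun p = ∑ s, a s • exteriorPower.ιMulti ℝ 2 (fun j => coordVector e (s j) p))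
    (f : Fin 2 → SmoothFun n M) :
    hkrValue α f p = ∑ s, (1 / 2 * a s) *
      (chartDeriv e (Pi.single (s 0) 1) (f 0) p * chartDeriv e (Pi.single (s 1) 1) (f 1) p
      - chartDeriv e (Pi.single (s 0) 1) (f 1) p * chartDeriv e (Pi.single (s 1) 1) (f 0) p) := by
  rw [hkrValue, ha, pairingDual_sum_coordVector he hp, Finset.mul_sum]
  simp [mul_assoc]

variable [IsManifold (𝓡 n) ∞ M]

theorem contMDiff_hkrValue (α : MultivectorField n M 2) (f : Fin 2 → SmoothFun n M) :
    ContMDiff (𝓡 n) 𝓘(ℝ, ℝ) ∞ (hkrValue α f) := by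
  intro p
  have he := IsManifold.chart_mem_maximalAtlas (I := 𝓡 n) (n := ∞) p
  obtain ⟨a, ha, h⟩ := α.smooth' _ he
  have hon : ContMDiffOn (𝓡 n) 𝓘(ℝ, ℝ) ∞ (hkrValue α f)
      (chartAt (EuclideanSpace ℝ (Fin n)) p).source := by
    refine ContMDiffOn.congr ?_ fun q hq => hkrValue_eq_sum he hq α (fun s => a s q) (h q hq) f
    refine contMDiffOn_finsetSum fun s _ => ContMDiffOn.mul (contMDiffOn_const.mul (ha s)) ?_
    exact ((contMDiffOn_chartDeriv he _ _).mul (contMDiffOn_chartDeriv he _ _)).sub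
      ((contMDiffOn_chartDeriv he _ _).mul (contMDiffOn_chartDeriv he _ _))
  exact hon.contMDiffAt ((chartAt (EuclideanSpace ℝ (Fin n)) p).open_source.mem_nhds
    (mem_chart_source _ p))

/-- The cochain `U₁(α)` of a bivector field `α`. -/
noncomputable def hkrCochain (α : MultivectorField n M 2) :
    HochschildCochain ℝ (SmoothFun n M) 2 :=
  MultilinearMap.mk' (fun f => ⟨hkrValue α f, contMDiff_hkrValue α f⟩)
    (fun f j x y => ContMDiffMap.ext fun p => hkrValue_update_add α f j x y p)
    (fun f j c x => ContMDiffMap.ext fun p => hkrValue_update_smul α f j c x p)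

theorem hkrCochain_apply (α : MultivectorField n M 2) (f : Fin 2 → SmoothFun n M) (p : M) :
    hkrCochain α f p = hkrValue α f p := rfl

theorem hkrCochain_mem_Dpoly (α : MultivectorField n M 2) : hkrCochain α ∈ Dpoly n M 2 := by
  classical
  refine isMultidifferentialOperator_of_sum
    (Finset.univ.image fun (s : Fin 2 → Fin n) k => Pi.single (s k) 1) fun e he => ?_
  obtain ⟨a, ha, h⟩ := α.smooth' _ he
  -- The two summands are the two terms of the determinant: the pair `s`, and the swapped pair with
  -- opposite sign.
  refine ⟨(Fin 2 → Fin n) ⊕ (Fin 2 → Fin n), inferInstance,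
    Sum.elim (fun s k => Pi.single (s k) 1) (fun s k => Pi.single (![s 1, s 0] k) 1),
    Sum.elim (fun s p => 1 / 2 * a s p) (fun s p => - (1 / 2 * a s p)), ?_, ?_, fun f p hp => ?_⟩
  · rintro (s | s)
    · exact Finset.mem_image_of_mem _ (Finset.mem_univ _)
    · exact Finset.mem_image_of_mem (fun (s : Fin 2 → Fin n) k => (Pi.single (s k) 1 : Fin n → ℕ))
        (Finset.mem_univ ![s 1, s 0])
  · rintro (s | s)
    · exact contMDiffOn_const.mul (ha s)
    · exact (contMDiffOn_const.mul (ha s)).neg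
  · rw [hkrCochain_apply, hkrValue_eq_sum he hp α (fun s => a s p) (h p hp),
      Fintype.sum_sum_type, ← Finset.sum_add_distrib]
    refine Finset.sum_congr rfl fun s _ => ?_
    simp only [Sum.elim_inl, Sum.elim_inr, Fin.prod_univ_two, Matrix.cons_val_zero,
      Matrix.cons_val_one]
    ring

theorem hkrCochain_antisymm (α : MultivectorField n M 2) (f g : SmoothFun n M) :
    hkrCochain α ![f, g] = - hkrCochain α ![g, f] := by
  refine ContMDiffMap.ext fun p => ?_
  have he := IsManifold.chart_mem_maximalAtlas (I := 𝓡 n) (n := ∞) p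
  have hp := mem_chart_source (EuclideanSpace ℝ (Fin n)) p
  obtain ⟨a, -, h⟩ := α.smooth' _ he
  change hkrCochain α _ p = - hkrCochain α _ p
  rw [hkrCochain_apply, hkrCochain_apply, hkrValue_eq_sum he hp α (fun s => a s p) (h p hp),
    hkrValue_eq_sum he hp α (fun s => a s p) (h p hp), ← Finset.sum_neg_distrib]
  refine Finset.sum_congr rfl fun s _ => ?_
  simp only [Matrix.cons_val_zero, Matrix.cons_val_one]
  ring

/-- In a chart each term is a product of derivations of the two arguments, and for these the cocycle
identity is the Leibniz rule. -/
theorem differential_hkrCochain (α : MultivectorField n M 2) :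
    HochschildCochain.differential ℝ (SmoothFun n M) 2 (hkrCochain α) = 0 := by
  refine HochschildCochain.ext fun f => ContMDiffMap.ext fun p => ?_
  have he := IsManifold.chart_mem_maximalAtlas (I := 𝓡 n) (n := ∞) p
  have hp := mem_chart_source (EuclideanSpace ℝ (Fin n)) p
  obtain ⟨a, -, h⟩ := α.smooth' _ he
  rw [HochschildCochain.differential_two_apply]
  change f 0 p * hkrValue α _ p - hkrValue α _ p + hkrValue α _ p - hkrValue α _ p * f 2 p = 0
  simp only [hkrValue_eq_sum he hp α (fun s => a s p) (h p hp), Finset.mul_sum, Finset.sum_mul,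
    ← Finset.sum_sub_distrib, ← Finset.sum_add_distrib]
  refine Finset.sum_eq_zero fun s _ => ?_
  simp only [Matrix.cons_val_zero, Matrix.cons_val_one, chartDeriv_single_mul he hp]
  ring

variable [T2Space M]

/-- Every linear form on a tangent space is the differential of a smooth function. -/
theorem exists_differentialAt_eq (p : M) (φ : Module.Dual ℝ (TangentSpace (𝓡 n) p)) :
    ∃ f : SmoothFun n M, differentialAt f p = φ := by
  have he := IsManifold.chart_mem_maximalAtlas (I := 𝓡 n) (n := ∞) p
  have hp := mem_chart_source (EuclideanSpace ℝ (Fin n)) p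
  have hmem := (chartAt (EuclideanSpace ℝ (Fin n)) p).map_source hp
  have hsurj := (mdifferentiable_chart (I := 𝓡 n) p).symm.mfderiv_surjective hmem
  set e := chartAt (EuclideanSpace ℝ (Fin n)) p
  have hq : ∃ A : EuclideanSpace ℝ (Fin n) →L[ℝ] EuclideanSpace ℝ (Fin n),
      A = mfderiv (𝓡 n) (𝓡 n) e.symm (e p) := ⟨_, rfl⟩
  obtain ⟨A, hA⟩ := hq
  let φ' : EuclideanSpace ℝ (Fin n) →ₗ[ℝ] ℝ := φ
  -- The function sought is the one that, read in the chart, is near `e p` the pullback of the form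
  -- under the derivative of `e.symm`.
  obtain ⟨f, hf⟩ := exists_smoothFun_eventuallyEq he hp
    ((LinearMap.toContinuousLinearMap φ').comp A).contDiff
  refine ⟨f, LinearMap.ext fun v => ?_⟩
  obtain ⟨u, hu⟩ := hsurj v
  have h1 : differentialAt f p (A u : EuclideanSpace ℝ (Fin n)) = φ' (A u) := by
    have h2 : fderiv ℝ (f ∘ e.symm) (e p) u = φ' (A u) := by
      rw [hf.fderiv_eq, ContinuousLinearMap.fderiv]
      rfl
    refine Eq.trans ?_ h2
    rw [hA]
    exact differentialAt_comp_mfderiv_symm he hp f u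
  have h2 : A u = (v : EuclideanSpace ℝ (Fin n)) := (DFunLike.congr_fun hA u).trans hu
  have h3 : ∀ w : EuclideanSpace ℝ (Fin n), A u = w →
      differentialAt f p (w : EuclideanSpace ℝ (Fin n)) = φ' w := by
    rintro _ rfl
    exact h1
  exact h3 v h2

/-- The coordinates of `w` in the induced basis of the exterior square are its pairings with wedges
of dual basis vectors, and each of those is a differential. -/
theorem eq_zero_of_forall_pairingDual (p : M) (w : ⋀[ℝ]^2 (TangentSpace (𝓡 n) p))
    (h : ∀ f : Fin 2 → SmoothFun n M, exteriorPower.pairingDual ℝ (TangentSpace (𝓡 n) p) 2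
      (exteriorPower.ιMulti ℝ 2 (fun j => differentialAt (f j) p)) w = 0) : w = 0 := by
  let b : Module.Basis (Fin n) ℝ (TangentSpace (𝓡 n) p) :=
    (EuclideanSpace.basisFun (Fin n) ℝ).toBasis
  refine (b.exteriorPower 2).ext_elem fun s => ?_
  rw [map_zero, exteriorPower.basis_repr_apply]
  choose f hf using fun j => exists_differentialAt_eq p
    ((b.coord ∘ Set.powersetCard.ofFinEmbEquiv.symm s) j)
  have := h f
  simp only [hf] at this
  exact this

theorem hkrCochain_injective {α : MultivectorField n M 2} (h : hkrCochain α = 0) : α = 0 := by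
  refine MultivectorField.ext (funext fun p => eq_zero_of_forall_pairingDual p _ fun f => ?_)
  have h1 : hkrCochain α f p = 0 := by rw [h]; rfl
  rw [hkrCochain_apply, hkrValue] at h1
  simpa using h1

end Bivector

/-! ### The symbol of a bidifferential cocycle at a point -/

section Symbol

/-- The value at `(ξ, η)` of the polynomial with coefficients `c J` at the multi-index `J`. -/
def bisymbol {n : ℕ} (S : Finset (Fin 2 → Fin n → ℕ)) (c : (Fin 2 → Fin n → ℕ) → ℝ)
    (ξ η : Fin n → ℝ) : ℝ :=
  ∑ J ∈ S, c J * ((∏ i, ξ i ^ J 0 i) * ∏ i, η i ^ J 1 i)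

/-- The polynomial whose radial derivative is the part of `bisymbol S c` linear in the first
variable. -/
noncomputable def primitiveSymbol {n : ℕ} (S : Finset (Fin 2 → Fin n → ℕ))
    (c : (Fin 2 → Fin n → ℕ) → ℝ) (ξ : Fin n → ℝ) : ℝ :=
  ∑ J ∈ S with ∑ i, J 0 i = 1, c J / (∑ i, (J 0 + J 1) i : ℕ) * ∏ i, ξ i ^ (J 0 + J 1) i

variable {n : ℕ} (S : Finset (Fin 2 → Fin n → ℕ)) (c : (Fin 2 → Fin n → ℕ) → ℝ)

theorem differentiable_bisymbol :
    Differentiable ℝ fun x : (Fin n → ℝ) × (Fin n → ℝ) => bisymbol S c x.1 x.2 := by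
  unfold bisymbol
  fun_prop

theorem prod_smul_pow (u : ℝ) (ξ : Fin n → ℝ) (J : Fin n → ℕ) :
    ∏ i, (u • ξ) i ^ J i = u ^ (∑ i, J i) * ∏ i, ξ i ^ J i := by
  simp only [Pi.smul_apply, smul_eq_mul, mul_pow, Finset.prod_mul_distrib,
    Finset.prod_pow_eq_pow_sum]

/-- A monomial of degree `k` in the first variable scales as `h ^ k` along `h • ξ`, so only `k = 1`
has nonzero derivative at 0. -/
theorem fderiv_bisymbol_zero (ξ η : Fin n → ℝ) :
    fderiv ℝ (fun x : (Fin n → ℝ) × (Fin n → ℝ) => bisymbol S c x.1 x.2) (0, η) (ξ, 0) =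
      ∑ J ∈ S with ∑ i, J 0 i = 1, c J * ((∏ i, ξ i ^ J 0 i) * ∏ i, η i ^ J 1 i) := by
  have h1 : HasDerivAt (fun h : ℝ => ((h • ξ, η) : (Fin n → ℝ) × (Fin n → ℝ))) (ξ, 0) 0 := by
    simpa using ((hasDerivAt_id (0 : ℝ)).smul_const ξ).prodMk (hasDerivAt_const (0 : ℝ) η)
  have h2 : HasFDerivAt (fun x : (Fin n → ℝ) × (Fin n → ℝ) => bisymbol S c x.1 x.2)
      (fderiv ℝ (fun x : (Fin n → ℝ) × (Fin n → ℝ) => bisymbol S c x.1 x.2) (0, η))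
      ((0 : ℝ) • ξ, η) := by
    rw [zero_smul]
    exact (differentiable_bisymbol S c _).hasFDerivAt
  refine (h2.comp_hasDerivAt (0 : ℝ) h1).unique ?_
  have h3 : ∀ J ∈ S, HasDerivAt
      (fun h : ℝ => c J * ((∏ i, (h • ξ) i ^ J 0 i) * ∏ i, η i ^ J 1 i))
      (if ∑ i, J 0 i = 1 then c J * ((∏ i, ξ i ^ J 0 i) * ∏ i, η i ^ J 1 i) else 0) 0 := by
    intro J _
    simp only [prod_smul_pow]
    refine ((((hasDerivAt_pow (∑ i, J 0 i) (0 : ℝ)).mul_const _).mul_const _).const_mul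
      _).congr_deriv ?_
    generalize ∑ i, J 0 i = k
    split_ifs with hk
    · simp [hk]
    · rcases k with _ | _ | k
      · simp
      · exact absurd rfl hk
      · simp
  rw [Finset.sum_filter]
  exact HasDerivAt.fun_sum h3

/-- Differentiating `u ^ (1 + |J 1|)` produces exactly the total degree by which the coefficient was
divided; that degree is at least 1. -/
theorem hasDerivAt_primitiveSymbol (ξ : Fin n → ℝ) (u : ℝ) :
    HasDerivAt (fun u : ℝ => primitiveSymbol S c (u • ξ))
      (fderiv ℝ (fun x : (Fin n → ℝ) × (Fin n → ℝ) => bisymbol S c x.1 x.2) (0, u • ξ) (ξ, 0))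
      u := by
  rw [fderiv_bisymbol_zero]
  refine HasDerivAt.fun_sum fun J hJ => ?_
  have hJ1 : ∑ i, J 0 i = 1 := (Finset.mem_filter.1 hJ).2
  simp only [prod_smul_pow]
  refine (((hasDerivAt_pow _ u).mul_const _).const_mul _).congr_deriv ?_
  simp only [Pi.add_apply, Finset.sum_add_distrib, hJ1, pow_add, Finset.prod_mul_distrib]
  have : ((1 + ∑ i, J 1 i : ℕ) : ℝ) ≠ 0 := by positivity
  rw [Nat.add_sub_cancel_left]
  field_simp

theorem primitiveSymbol_zero : primitiveSymbol S c 0 = 0 := by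
  refine Finset.sum_eq_zero fun J hJ => ?_
  have hJ1 : ∑ i, J 0 i = 1 := (Finset.mem_filter.1 hJ).2
  have := prod_smul_pow 0 0 (J 0 + J 1)
  rw [zero_smul] at this
  rw [this, zero_pow, zero_mul, mul_zero]
  simp [Finset.sum_add_distrib, hJ1]

theorem sum_sum_eq_sum_fin_two (F : Fin n → Fin n → ℝ) :
    ∑ i, ∑ j, F i j = ∑ s : Fin 2 → Fin n, F (s 0) (s 1) := by
  rw [← Fintype.sum_prod_type']
  exact (Fintype.sum_equiv (finTwoArrowEquiv (Fin n)) _ _ fun s => rfl).symm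

end Symbol

/-! ### The symbol of a cocycle and its antisymmetric part -/

section Cocycle

variable {n : ℕ} {M : Type*} [TopologicalSpace M] [ChartedSpace (EuclideanSpace ℝ (Fin n)) M]
  {e : OpenPartialHomeomorph M (EuclideanSpace ℝ (Fin n))} {p : M}

theorem sum_mem_jetFunctionals {m : ℕ} (S : Finset (Fin m → Fin n → ℕ))
    (c : (Fin m → Fin n → ℕ) → ℝ) :
    (fun f : Fin m → SmoothFun n M => ∑ J ∈ S, c J * ∏ k, chartDeriv e (J k) (f k) p) ∈
      jetFunctionals e p m := by
  have : (fun f : Fin m → SmoothFun n M => ∑ J ∈ S, c J * ∏ k, chartDeriv e (J k) (f k) p) =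
      ∑ J ∈ S, c J • fun f : Fin m → SmoothFun n M => ∏ k, chartDeriv e (J k) (f k) p := by
    funext f
    simp [Finset.sum_apply]
  rw [this]
  exact Submodule.sum_mem _ fun J _ =>
    Submodule.smul_mem _ _ (prod_chartDeriv_mem_jetFunctionals J)

theorem mul_mem_jetFunctionals (J K : Fin n → ℕ) :
    (fun f : Fin 2 → SmoothFun n M => chartDeriv e J (f 0) p * chartDeriv e K (f 1) p) ∈
      jetFunctionals e p 2 := by
  have := prod_chartDeriv_mem_jetFunctionals (M := M) (e := e) (p := p) ![J, K]
  simpa [Fin.prod_univ_two] using this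

variable {B : HochschildCochain ℝ (SmoothFun n M) 2}
  {S : Finset (Fin 2 → Fin n → ℕ)} {c : (Fin 2 → Fin n → ℕ) → ℝ}

theorem apply_eq_bisymbol
    (hB : ∀ f, B f p = ∑ J ∈ S, c J * ∏ k, chartDeriv e (J k) (f k) p)
    {ξ η : Fin n → ℝ} {f g : SmoothFun n M}
    (hf : f ∘ e.symm =ᶠ[nhds (e p)] expFun (e p) ξ)
    (hg : g ∘ e.symm =ᶠ[nhds (e p)] expFun (e p) η) :
    B ![f, g] p = bisymbol S c ξ η := by
  rw [hB]
  refine Finset.sum_congr rfl fun J _ => ?_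
  simp [Fin.prod_univ_two, chartDeriv_of_eventuallyEq_expFun hf,
    chartDeriv_of_eventuallyEq_expFun hg]

variable [IsManifold (𝓡 n) ∞ M] [T2Space M]

/-- Evaluate `dB = 0` on three exponentials: the outer factors are 1 at `p`, and products have
frequencies `ξ + η` and `η + ζ`. -/
theorem bisymbol_cocycle (he : e ∈ IsManifold.maximalAtlas (𝓡 n) ∞ M) (hp : p ∈ e.source)
    (hB : ∀ f, B f p = ∑ J ∈ S, c J * ∏ k, chartDeriv e (J k) (f k) p)
    (hd : HochschildCochain.differential ℝ (SmoothFun n M) 2 B = 0) (ξ η ζ : Fin n → ℝ) :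
    bisymbol S c η ζ - bisymbol S c (ξ + η) ζ + bisymbol S c ξ (η + ζ) - bisymbol S c ξ η = 0 := by
  obtain ⟨f, hf⟩ := exists_smoothFun_eventuallyEq he hp (contDiff_expFun (e p) ξ)
  obtain ⟨g, hg⟩ := exists_smoothFun_eventuallyEq he hp (contDiff_expFun (e p) η)
  obtain ⟨h, hh⟩ := exists_smoothFun_eventuallyEq he hp (contDiff_expFun (e p) ζ)
  have h1 := HochschildCochain.differential_two_apply B ![f, g, h]
  rw [hd] at h1
  have h2 : (0 : ℝ) = f p * B ![g, h] p - B ![f * g, h] p + B ![f, g * h] p - B ![f, g] p * h p :=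
    congrArg (fun φ : SmoothFun n M => φ p) h1
  rw [apply_eq_bisymbol hB hg hh, apply_eq_bisymbol hB (mul_eventuallyEq_expFun hf hg) hh,
    apply_eq_bisymbol hB hf (mul_eventuallyEq_expFun hg hh), apply_eq_bisymbol hB hf hg,
    apply_of_eventuallyEq_expFun hp hf, apply_of_eventuallyEq_expFun hp hh] at h2
  linarith

/-- The antisymmetrization of a bidifferential cocycle is of first order in both arguments. -/
theorem antisymm_eq_sum_chartDeriv (he : e ∈ IsManifold.maximalAtlas (𝓡 n) ∞ M)
    (hp : p ∈ e.source) (hB : ∀ f, B f p = ∑ J ∈ S, c J * ∏ k, chartDeriv e (J k) (f k) p)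
    (hd : HochschildCochain.differential ℝ (SmoothFun n M) 2 B = 0) (f g : SmoothFun n M) :
    B ![f, g] p - B ![g, f] p = ∑ s : Fin 2 → Fin n,
      (bisymbol S c (Pi.single (s 0) 1) (Pi.single (s 1) 1) -
        bisymbol S c (Pi.single (s 1) 1) (Pi.single (s 0) 1)) *
      (chartDeriv e (Pi.single (s 0) 1) f p * chartDeriv e (Pi.single (s 1) 1) g p) := by
  -- The difference of the two sides as a functional of finite order; it suffices that it vanishes
  -- on exponentials.
  let L : (Fin 2 → SmoothFun n M) → ℝ := fun f =>
    (∑ J ∈ S, c J * ∏ k, chartDeriv e (J k) (f k) p) -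
    (∑ J ∈ S, c J * (chartDeriv e (J 1) (f 0) p * chartDeriv e (J 0) (f 1) p)) -
    ∑ s : Fin 2 → Fin n, (bisymbol S c (Pi.single (s 0) 1) (Pi.single (s 1) 1) -
        bisymbol S c (Pi.single (s 1) 1) (Pi.single (s 0) 1)) *
      (chartDeriv e (Pi.single (s 0) 1) (f 0) p * chartDeriv e (Pi.single (s 1) 1) (f 1) p)
  have hsum {ι : Type} (T : Finset ι) (c : ι → ℝ) (J K : ι → Fin n → ℕ) :
      (fun f : Fin 2 → SmoothFun n M =>
        ∑ j ∈ T, c j * (chartDeriv e (J j) (f 0) p * chartDeriv e (K j) (f 1) p)) ∈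
      jetFunctionals e p 2 := by
    have := Submodule.sum_mem (jetFunctionals e p 2) (t := T) fun j _ =>
      Submodule.smul_mem _ (c j) (mul_mem_jetFunctionals (M := M) (J j) (K j))
    convert this using 1
    funext f
    simp [Finset.sum_apply]
  have hL : L ∈ jetFunctionals e p 2 :=
    Submodule.sub_mem _ (Submodule.sub_mem _ (sum_mem_jetFunctionals S c) (hsum _ _ _ _))
      (hsum _ _ _ _)
  have hswap (f g : SmoothFun n M) : B ![g, f] p =
      ∑ J ∈ S, c J * (chartDeriv e (J 1) f p * chartDeriv e (J 0) g p) := by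
    rw [hB]
    simp [Fin.prod_univ_two, mul_comm]
  have h0 : L = 0 := by
    refine eq_zero_of_mem_jetFunctionals he hp hL fun ξ f hf => ?_
    have hcont : Continuous (Function.uncurry (bisymbol S c)) :=
      (differentiable_bisymbol S c).continuous
    have key := antisymm_eq_sum_of_cocycle (bisymbol_cocycle he hp hB hd) hcont (ξ 0) (ξ 1)
    rw [sum_sum_eq_sum_fin_two fun i j => ξ 0 i * ξ 1 j *
      (bisymbol S c (Pi.single i 1) (Pi.single j 1) -
        bisymbol S c (Pi.single j 1) (Pi.single i 1))] at key
    have hf2 : (![f 0, f 1] : Fin 2 → SmoothFun n M) = f := by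
      funext i; fin_cases i <;> rfl
    have hmono (ξ : Fin n → ℝ) (i : Fin n) :
        ∏ j, ξ j ^ (Pi.single i 1 : Fin n → ℕ) j = ξ i := by
      rw [Finset.prod_eq_single i (fun j _ hj => by simp [hj]) (by simp)]
      simp
    simp only [L]
    rw [← apply_eq_bisymbol hB (hf 0) (hf 1), ← apply_eq_bisymbol hB (hf 1) (hf 0), hf2] at key
    rw [← hB, ← hswap, key, sub_eq_zero]
    refine Finset.sum_congr rfl fun s _ => ?_
    rw [chartDeriv_of_eventuallyEq_expFun (hf 0), chartDeriv_of_eventuallyEq_expFun (hf 1),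
      hmono, hmono]
    ring
  have := congrFun h0 ![f, g]
  simp only [L, ← hB] at this
  simp only [Matrix.cons_val_zero, Matrix.cons_val_one, ← hswap] at this
  exact sub_eq_zero.1 this

/-- The bivector field of a bidifferential cocycle. -/
theorem exists_hkrCochain_eq_antisymm (hB : B ∈ Dpoly n M 2)
    (hd : HochschildCochain.differential ℝ (SmoothFun n M) 2 B = 0) :
    ∃ α : MultivectorField n M 2, ∀ (f g : SmoothFun n M) (p : M),
      2 * hkrCochain α ![f, g] p = B ![f, g] p - B ![g, f] p := by
  obtain ⟨S, hS⟩ := hB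
  have hloc : ∀ e ∈ IsManifold.maximalAtlas (𝓡 n) ∞ M, ∃ a : (Fin 2 → Fin n) → M → ℝ,
      (∀ s, ContMDiffOn (𝓡 n) 𝓘(ℝ, ℝ) ∞ (a s) e.source) ∧
      ∀ p ∈ e.source, ∀ f : Fin 2 → SmoothFun n M,
        exteriorPower.pairingDual ℝ (TangentSpace (𝓡 n) p) 2
          (exteriorPower.ιMulti ℝ 2 (fun j => differentialAt (f j) p))
          (∑ s, a s p • exteriorPower.ιMulti ℝ 2 (fun j => coordVector e (s j) p)) =
        B ![f 0, f 1] p - B ![f 1, f 0] p := by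
    intro e he
    obtain ⟨C, hC, h⟩ := hS e he
    have hsm (ξ η : Fin n → ℝ) : ContMDiffOn (𝓡 n) 𝓘(ℝ, ℝ) ∞
        (fun p => bisymbol S (fun J => C J p) ξ η) e.source :=
      contMDiffOn_finsetSum fun J _ => (hC J).mul contMDiffOn_const
    -- The sum runs over ordered pairs and the determinant antisymmetrizes again, so each term is
    -- counted twice; hence the 1/2. The further 1/2 in `U₁` accounts for the 2 in the conclusion.
    refine ⟨fun s p => 1 / 2 *
      (bisymbol S (fun J => C J p) (Pi.single (s 0) 1) (Pi.single (s 1) 1) -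
        bisymbol S (fun J => C J p) (Pi.single (s 1) 1) (Pi.single (s 0) 1)),
      fun s => contMDiffOn_const.mul ((hsm _ _).sub (hsm _ _)), fun p hp f => ?_⟩
    have h1 := antisymm_eq_sum_chartDeriv he hp (c := fun J => C J p) (fun f => h f p hp) hd
    rw [pairingDual_sum_coordVector he hp]
    have h2 := congrArg₂ (fun x y : ℝ => 1 / 2 * (x - y)) (h1 (f 0) (f 1)) (h1 (f 1) (f 0))
    simp only [Finset.mul_sum, ← Finset.sum_sub_distrib] at h2
    have h3 : B ![f 0, f 1] p - B ![f 1, f 0] p = 1 / 2 * (B ![f 0, f 1] p - B ![f 1, f 0] p -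
        (B ![f 1, f 0] p - B ![f 0, f 1] p)) := by ring
    rw [h3, h2]
    refine Finset.sum_congr rfl fun s _ => by ring
  choose! a ha h using hloc
  have hmem (p : M) := IsManifold.chart_mem_maximalAtlas (I := 𝓡 n) (n := ∞) p
  have hsrc (p : M) := mem_chart_source (EuclideanSpace ℝ (Fin n)) p
  -- The value at `p` is defined in the preferred chart at `p`. In any other chart the local formula
  -- has the same pairings with all `df ∧ dg`, hence the same value, which gives smoothness.
  refine ⟨⟨fun p => ∑ s, a (chartAt _ p) s p •
    exteriorPower.ιMulti ℝ 2 (fun j => coordVector (chartAt _ p) (s j) p),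
    fun e he => ⟨a e, ha e he, fun p hp => ?_⟩⟩, fun f g p => ?_⟩
  · rw [← sub_eq_zero]
    refine eq_zero_of_forall_pairingDual p _ fun f => ?_
    rw [map_sub, h _ (hmem p) p (hsrc p), h e he p hp, sub_self]
  · rw [hkrCochain_apply, hkrValue, h _ (hmem p) p (hsrc p)]
    simp

end Cocycle

/-! ### Symmetric bidifferential cocycles are coboundaries -/

section SymmetricCocycle

variable {n : ℕ} {M : Type*} [TopologicalSpace M] [ChartedSpace (EuclideanSpace ℝ (Fin n)) M]
  [IsManifold (𝓡 n) ∞ M] [T2Space M]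
  {e : OpenPartialHomeomorph M (EuclideanSpace ℝ (Fin n))} {p : M}
  {B : HochschildCochain ℝ (SmoothFun n M) 2}

/-- In a chart, a symmetric bidifferential cocycle is the coboundary of an explicit differential
operator. -/
theorem coboundary_eq_of_symm {S : Finset (Fin 2 → Fin n → ℕ)} {c : (Fin 2 → Fin n → ℕ) → ℝ}
    (he : e ∈ IsManifold.maximalAtlas (𝓡 n) ∞ M)
    (hp : p ∈ e.source) (hB : ∀ f, B f p = ∑ J ∈ S, c J * ∏ k, chartDeriv e (J k) (f k) p)
    (hd : HochschildCochain.differential ℝ (SmoothFun n M) 2 B = 0)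
    (hsymm : ∀ f g, B ![f, g] = B ![g, f]) {T : SmoothFun n M → ℝ}
    (hT : ∀ f : SmoothFun n M, T f = -bisymbol S c 0 0 * f p + ∑ J ∈ S with ∑ i, J 0 i = 1,
      c J / (∑ i, (J 0 + J 1) i : ℕ) * chartDeriv e (J 0 + J 1) f p) (f g : SmoothFun n M) :
    T (f * g) - f p * T g - T f * g p = B ![f, g] p := by
  let L : (Fin 2 → SmoothFun n M) → ℝ := fun f =>
    T (f 0 * f 1) - f 0 p * T (f 1) - T (f 0) * f 1 p -
      ∑ J ∈ S, c J * ∏ k, chartDeriv e (J k) (f k) p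
  -- The symbol of `T` is the primitive shifted by `-s(0, 0)`; in `T(f g) - f T(g) - T(f) g` the
  -- shift contributes `+s(0, 0)`, the constant missing from the coboundary formula.
  have hTexp {ξ : Fin n → ℝ} {f : SmoothFun n M}
      (hf : f ∘ e.symm =ᶠ[nhds (e p)] expFun (e p) ξ) :
      T f = -bisymbol S c 0 0 + primitiveSymbol S c ξ := by
    rw [hT, apply_of_eventuallyEq_expFun hp hf, mul_one]
    congr 1
    exact Finset.sum_congr rfl fun J _ => by rw [chartDeriv_of_eventuallyEq_expFun hf]
  have hsym (ξ η : Fin n → ℝ) : bisymbol S c ξ η = bisymbol S c η ξ := by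
    obtain ⟨f, hf⟩ := exists_smoothFun_eventuallyEq he hp (contDiff_expFun (e p) ξ)
    obtain ⟨g, hg⟩ := exists_smoothFun_eventuallyEq he hp (contDiff_expFun (e p) η)
    rw [← apply_eq_bisymbol hB hf hg, hsymm, apply_eq_bisymbol hB hg hf]
  -- Reading `f p` as a derivative of order 0 puts every term of `L` into the form required of a jet
  -- functional.
  have hval (f : SmoothFun n M) : f p = chartDeriv e 0 f p := (chartDeriv_zero hp f).symm
  have hL : L ∈ jetFunctionals e p 2 := by
    have hlin {φ : (Fin n → ℕ) → (Fin 2 → SmoothFun n M) → ℝ}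
        (hφ : ∀ J, φ J ∈ jetFunctionals e p 2) :
        (fun f => -bisymbol S c 0 0 * φ 0 f + ∑ J ∈ S with ∑ i, J 0 i = 1,
          c J / (∑ i, (J 0 + J 1) i : ℕ) * φ (J 0 + J 1) f) ∈ jetFunctionals e p 2 := by
      have := Submodule.add_mem _ (Submodule.smul_mem _ (-bisymbol S c 0 0) (hφ 0))
        (Submodule.sum_mem (jetFunctionals e p 2) (t := S.filter fun J => ∑ i, J 0 i = 1)
          fun J _ => Submodule.smul_mem _ (c J / (∑ i, (J 0 + J 1) i : ℕ)) (hφ (J 0 + J 1)))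
      convert this using 1
      funext f
      simp [Finset.sum_apply]
    refine Submodule.sub_mem _ (Submodule.sub_mem _ (Submodule.sub_mem _ ?_ ?_) ?_)
      (sum_mem_jetFunctionals S c)
    · convert hlin (fun J => chartDeriv_mul_mem_jetFunctionals (M := M) he hp J) using 2
      rw [hT, hval]
    · convert hlin (fun J => mul_mem_jetFunctionals (M := M) (e := e) (p := p) 0 J) using 2
      rw [hT, hval, hval, mul_add, Finset.mul_sum]
      congr 1
      · ring
      · exact Finset.sum_congr rfl fun J _ => by ring
    · convert hlin (fun J => mul_mem_jetFunctionals (M := M) (e := e) (p := p) J 0) using 2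
      rw [hT, hval, hval, add_mul, Finset.sum_mul]
      congr 1
      · ring
      · exact Finset.sum_congr rfl fun J _ => by ring
  have h0 : L = 0 := by
    refine eq_zero_of_mem_jetFunctionals he hp hL fun ξ f hf => ?_
    have hf2 : (![f 0, f 1] : Fin 2 → SmoothFun n M) = f := by
      funext i; fin_cases i <;> rfl
    have key := coboundary_of_symm_cocycle (bisymbol_cocycle he hp hB hd) hsym
      (differentiable_bisymbol S c) (hasDerivAt_primitiveSymbol S c) (ξ 0) (ξ 1)
    rw [primitiveSymbol_zero, ← apply_eq_bisymbol hB (hf 0) (hf 1), hf2] at key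
    simp only [L]
    rw [← hB, hTexp (hf 0), hTexp (hf 1), hTexp (mul_eventuallyEq_expFun (hf 0) (hf 1)),
      apply_of_eventuallyEq_expFun hp (hf 0), apply_of_eventuallyEq_expFun hp (hf 1)]
    linarith
  have := congrFun h0 ![f, g]
  simp only [L, ← hB] at this
  exact sub_eq_zero.1 this

theorem mem_boundedMultiIndices {J : Fin n → ℕ} {r : ℕ} (h : ∑ i, J i ≤ r) :
    J ∈ boundedMultiIndices n r :=
  Fintype.mem_piFinset.2 fun i => Finset.mem_range.2
    (Nat.lt_succ_of_le ((Finset.single_le_sum (fun _ _ => Nat.zero_le _) (Finset.mem_univ i)).trans h))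

theorem sum_le_of_mem_boundedMultiIndices {J : Fin n → ℕ} {r : ℕ}
    (h : J ∈ boundedMultiIndices n r) : ∑ i, J i ≤ n * r := by
  refine (Finset.sum_le_card_nsmul _ _ r fun i _ => ?_).trans (by simp)
  exact Nat.le_of_lt_succ (Finset.mem_range.1 (Fintype.mem_piFinset.1 h i))

/-- A symmetric bidifferential cocycle has primitives of uniformly bounded order in all charts. -/
theorem exists_local_primitive (hB : B ∈ Dpoly n M 2)
    (hd : HochschildCochain.differential ℝ (SmoothFun n M) 2 B = 0)
    (hsymm : ∀ f g, B ![f, g] = B ![g, f]) :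
    ∃ r : ℕ, ∀ e ∈ IsManifold.maximalAtlas (𝓡 n) ∞ M, ∃ g : (Fin n → ℕ) → M → ℝ,
      (∀ K, ContMDiffOn (𝓡 n) 𝓘(ℝ, ℝ) ∞ (g K) e.source) ∧
      ∀ p ∈ e.source, ∀ f h : SmoothFun n M,
        ∑ K ∈ boundedMultiIndices n r, g K p * chartDeriv e K (f * h : SmoothFun n M) p
        - f p * ∑ K ∈ boundedMultiIndices n r, g K p * chartDeriv e K h p
        - (∑ K ∈ boundedMultiIndices n r, g K p * chartDeriv e K f p) * h p = B ![f, h] p := by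
  classical
  obtain ⟨S, hS⟩ := hB
  -- The largest total order of a merged multi-index; it is the same for all charts because `S` is.
  let r := S.sup fun J => ∑ i, (J 0 + J 1) i
  refine ⟨r, fun e he => ?_⟩
  obtain ⟨C, hC, h⟩ := hS e he
  let g (K : Fin n → ℕ) (p : M) : ℝ := -(if 0 = K then bisymbol S (fun J => C J p) 0 0 else 0) +
    ∑ J ∈ S with ∑ i, J 0 i = 1,
      if J 0 + J 1 = K then C J p / (∑ i, (J 0 + J 1) i : ℕ) else 0
  refine ⟨g, fun K => ?_, fun p hp => coboundary_eq_of_symm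
    (T := fun f => ∑ K ∈ boundedMultiIndices n r, g K p * chartDeriv e K f p)
    he hp (fun f => h f p hp) hd hsymm fun f => ?_⟩
  · refine ContMDiffOn.add (ContMDiffOn.neg ?_) (contMDiffOn_finsetSum fun J _ => ?_)
    · split_ifs
      · exact contMDiffOn_finsetSum fun J _ => (hC J).mul contMDiffOn_const
      · exact contMDiffOn_const
    · split_ifs
      · simp only [div_eq_mul_inv]
        exact (hC J).mul contMDiffOn_const
      · exact contMDiffOn_const
  · have h0 : (0 : Fin n → ℕ) ∈ boundedMultiIndices n r := mem_boundedMultiIndices (by simp)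
    simp only [g, add_mul, Finset.sum_add_distrib, neg_mul, ite_mul, zero_mul, Finset.sum_neg_distrib,
      Finset.sum_ite_eq, h0, if_true, Finset.sum_mul, chartDeriv_zero hp]
    congr 1
    rw [Finset.sum_comm]
    refine Finset.sum_congr rfl fun J hJ => ?_
    have hmem : J 0 + J 1 ∈ boundedMultiIndices n r :=
      mem_boundedMultiIndices
        (Finset.le_sup (f := fun J : Fin 2 → Fin n → ℕ => ∑ i, (J 0 + J 1) i)
          (Finset.mem_filter.1 hJ).1)
    simp only [Finset.sum_ite_eq, hmem, if_true]

variable [SecondCountableTopology M]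

/-- Differential operators of bounded order on the charts of the atlas can be glued by a partition
of unity. -/
theorem exists_glued_operator (r : ℕ) (g : M → (Fin n → ℕ) → M → ℝ)
    (hg : ∀ a K, ContMDiffOn (𝓡 n) 𝓘(ℝ, ℝ) ∞ (g a K)
      (chartAt (EuclideanSpace ℝ (Fin n)) a).source) :
    ∃ (T : HochschildCochain ℝ (SmoothFun n M) 1) (N : M → Finset M) (ρ : M → M → ℝ),
      T ∈ Dpoly n M 1 ∧
      ∀ p, (∀ a ∈ N p, p ∈ (chartAt (EuclideanSpace ℝ (Fin n)) a).source) ∧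
        ∑ a ∈ N p, ρ a p = 1 ∧
        ∀ f : SmoothFun n M, T ![f] p = ∑ a ∈ N p, ρ a p * ∑ K ∈ boundedMultiIndices n r,
          g a K p * chartDeriv (chartAt (EuclideanSpace ℝ (Fin n)) a) K f p := by
  have : LocallyCompactSpace M :=
    ChartedSpace.locallyCompactSpace (EuclideanSpace ℝ (Fin n)) M
  obtain ⟨ρ, hρ⟩ := SmoothPartitionOfUnity.exists_isSubordinate_chartAt_source (𝓡 n) M
  have hmem (a : M) := IsManifold.chart_mem_maximalAtlas (I := 𝓡 n) (n := ∞) a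
  have hfin {a p : M} (ha : a ∈ ρ.finsupport p) :
      p ∈ (chartAt (EuclideanSpace ℝ (Fin n)) a).source :=
    hρ a (subset_tsupport _ ((ρ.mem_finsupport p).1 ha))
  let τ (f : SmoothFun n M) (p : M) : ℝ := ∑ a ∈ ρ.finsupport p, ρ a p *
    ∑ K ∈ boundedMultiIndices n r, g a K p * chartDeriv (chartAt _ a) K f p
  have hloc : ∀ e ∈ IsManifold.maximalAtlas (𝓡 n) ∞ M, ∃ H : (Fin n → ℕ) → M → ℝ,
      (∀ K, ContMDiffOn (𝓡 n) 𝓘(ℝ, ℝ) ∞ (H K) e.source) ∧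
      ∀ (f : SmoothFun n M), ∀ p ∈ e.source,
        τ f p = ∑ K ∈ boundedMultiIndices n (n * r), H K p * chartDeriv e K f p := by
    intro e he
    -- Derivatives in the chart at `a` are rewritten in the fixed chart `e`. Entries bounded by `r`
    -- only bound the total order by `n * r`, hence the larger index set.
    choose! C hC hCe using fun (a : M) (K : Fin n → ℕ) (hK : K ∈ boundedMultiIndices n r) =>
      exists_chartDeriv_eq_sum (hmem a) he (sum_le_of_mem_boundedMultiIndices hK)
    let h (a : M) (K' : Fin n → ℕ) (p : M) : ℝ :=
      ∑ K ∈ boundedMultiIndices n r, g a K p * C a K K' p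
    refine ⟨fun K' p => ∑ᶠ a, ρ a p • h a K' p, fun K' p hp => ?_, fun f p hp => ?_⟩
    -- Smoothness of `h a K'` is needed only on the closed support of `ρ a`, which lies in the chart
    -- domain at `a`.
    · refine (ρ.contMDiffAt_finsum fun a ha => ?_).contMDiffWithinAt
      have hpa := hρ a ha
      have hon : ContMDiffOn (𝓡 n) 𝓘(ℝ, ℝ) ∞ (h a K')
          ((chartAt (EuclideanSpace ℝ (Fin n)) a).source ∩ e.source) :=
        contMDiffOn_finsetSum fun K hK =>
          ((hg a K).mono Set.inter_subset_left).mul (hC a K hK K')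
      exact hon.contMDiffAt (((chartAt _ a).open_source.inter e.open_source).mem_nhds ⟨hpa, hp⟩)
    · have hsum (K' : Fin n → ℕ) : ∑ᶠ a, ρ a p * h a K' p = ∑ a ∈ ρ.finsupport p, ρ a p * h a K' p :=
        (ρ.sum_finsupport_smul_eq_finsum p fun a => h a K').symm
      simp only [hsum, Finset.sum_mul, smul_eq_mul]
      rw [Finset.sum_comm]
      change ∑ a ∈ ρ.finsupport p, _ = _
      refine Finset.sum_congr rfl fun a ha => ?_
      simp only [h, mul_assoc, Finset.sum_mul, Finset.mul_sum]
      rw [Finset.sum_comm]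
      refine Finset.sum_congr rfl fun K hK => ?_
      rw [hCe a K hK f p ⟨hfin ha, hp⟩, Finset.mul_sum, Finset.mul_sum]
  have hsmooth (f : SmoothFun n M) : ContMDiff (𝓡 n) 𝓘(ℝ, ℝ) ∞ (τ f) := by
    intro p
    obtain ⟨H, hH, h⟩ := hloc _ (hmem p)
    refine ContMDiffOn.contMDiffAt (ContMDiffOn.congr ?_ (h f))
      ((chartAt (EuclideanSpace ℝ (Fin n)) p).open_source.mem_nhds (mem_chart_source _ p))
    exact contMDiffOn_finsetSum fun K _ => (hH K).mul (contMDiffOn_chartDeriv (hmem p) K f)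
  let T : SmoothFun n M →ₗ[ℝ] SmoothFun n M :=
    { toFun := fun f => ⟨τ f, hsmooth f⟩
      map_add' := fun f f' => ContMDiffMap.ext fun p => by
        change τ _ p = τ _ p + τ _ p
        obtain ⟨H, -, h⟩ := hloc _ (hmem p)
        have hp := mem_chart_source (EuclideanSpace ℝ (Fin n)) p
        simp only [h _ p hp, chartDeriv_add (hmem p) hp, mul_add, Finset.sum_add_distrib]
      map_smul' := fun c f => ContMDiffMap.ext fun p => by
        change τ _ p = c * τ _ p
        obtain ⟨H, -, h⟩ := hloc _ (hmem p)
        have hp := mem_chart_source (EuclideanSpace ℝ (Fin n)) p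
        simp only [h _ p hp, chartDeriv_smul (hmem p) hp, Finset.mul_sum, mul_left_comm] }
  let T' : HochschildCochain ℝ (SmoothFun n M) 1 :=
    MultilinearMap.ofSubsingleton ℝ (SmoothFun n M) (SmoothFun n M) (0 : Fin 1) T
  refine ⟨T', ρ.finsupport, fun a => ρ a, ?_,
    fun p => ⟨fun a ha => hfin ha, ρ.sum_finsupport p (Set.mem_univ p), fun f => rfl⟩⟩
  refine isMultidifferentialOperator_of_sum
    ((boundedMultiIndices n (n * r)).image fun K _ => K) fun e he => ?_
  obtain ⟨H, hH, h⟩ := hloc e he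
  refine ⟨boundedMultiIndices n (n * r), inferInstance, fun K _ => K, fun K => H K,
    fun K => Finset.mem_image_of_mem _ K.2, fun K => hH K, fun f p hp => ?_⟩
  refine (h (f 0) p hp).trans ?_
  rw [← Finset.sum_coe_sort]
  exact Finset.sum_congr rfl fun K _ => by rw [Fin.prod_univ_one]

/-- At each point the coboundary equation is linear in the primitive, so local solutions averaged
with weights of sum 1 again solve it for `B`. -/
theorem mem_coboundaries_of_symm (hB : B ∈ Dpoly n M 2)
    (hd : HochschildCochain.differential ℝ (SmoothFun n M) 2 B = 0)
    (hsymm : ∀ f g, B ![f, g] = B ![g, f]) :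
    B ∈ HochschildCochain.coboundaries (Dpoly n M) 1 := by
  obtain ⟨r, h⟩ := exists_local_primitive hB hd hsymm
  choose g hg hgB using fun a : M =>
    h _ (IsManifold.chart_mem_maximalAtlas (I := 𝓡 n) (n := ∞) a)
  obtain ⟨T, N, ρ, hTD, hT⟩ := exists_glued_operator r g hg
  refine ⟨T, hTD, HochschildCochain.ext fun f => ContMDiffMap.ext fun p => ?_⟩
  obtain ⟨hN, h1, hTp⟩ := hT p
  rw [HochschildCochain.differential_one_apply]
  change T _ p - f 0 p * T _ p - T _ p * f 1 p = B f p
  have hf2 : (![f 0, f 1] : Fin 2 → SmoothFun n M) = f := by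
    funext i; fin_cases i <;> rfl
  rw [hTp, hTp, hTp, Finset.mul_sum, Finset.sum_mul, ← Finset.sum_sub_distrib,
    ← Finset.sum_sub_distrib, ← one_mul (B f p), ← h1, Finset.sum_mul]
  refine Finset.sum_congr rfl fun a ha => ?_
  rw [← hf2, ← hgB a p (hN a ha)]
  simp only [Matrix.cons_val_zero, Matrix.cons_val_one]
  ring

end SymmetricCocycle

/-! ### The Hochschild-Kostant-Rosenberg isomorphism in degree one -/

section Isomorphism

variable {n : ℕ} {M : Type*} [TopologicalSpace M] [ChartedSpace (EuclideanSpace ℝ (Fin n)) M]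

/-- Commutativity makes `T(f g) - f T(g) - T(f) g` symmetric in `f` and `g`. -/
theorem coboundary_symm {B : HochschildCochain ℝ (SmoothFun n M) 2}
    (hB : B ∈ HochschildCochain.coboundaries (Dpoly n M) 1) (f g : SmoothFun n M) :
    B ![f, g] = B ![g, f] := by
  obtain ⟨T, -, rfl⟩ := hB
  rw [HochschildCochain.differential_one_apply, HochschildCochain.differential_one_apply]
  simp only [Matrix.cons_val_zero, Matrix.cons_val_one]
  rw [mul_comm f g]
  ring

variable [IsManifold (𝓡 n) ∞ M]

/-- The map `α ↦ U₁(α)` from bivector fields to bidifferential cocycles. -/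
noncomputable def hkrCocycle :
    Tpoly n M 1 →ₗ[SmoothFun n M] HochschildCochain.cocycles (Dpoly n M) 1 where
  toFun α := ⟨hkrCochain α, hkrCochain_mem_Dpoly α, differential_hkrCochain α⟩
  map_add' α β := Subtype.ext (HochschildCochain.ext fun f => ContMDiffMap.ext fun p => by
    change hkrValue (α + β) f p = hkrValue α f p + hkrValue β f p
    unfold hkrValue
    rw [← mul_add, ← map_add]
    rfl)
  map_smul' h α := Subtype.ext (HochschildCochain.ext fun f => ContMDiffMap.ext fun p => by
    change hkrValue (h • α) f p = h p * hkrValue α f p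
    unfold hkrValue
    rw [mul_left_comm, ← smul_eq_mul (h p), ← map_smul]
    rfl)

end Isomorphism

theorem proposition4p2 (n : ℕ) (M : Type*) [TopologicalSpace M] [T2Space M]
    [SecondCountableTopology M] [ChartedSpace (EuclideanSpace ℝ (Fin n)) M]
    [IsManifold (𝓡 n) ∞ M] :
    ∃ Φ : Tpoly n M 1 ≃ₗ[SmoothFun n M] HochschildCochain.Cohomology (Dpoly n M) 1,
      ∀ α : Tpoly n M 1, ∃ B : HochschildCochain.cocycles (Dpoly n M) 1,
        (∀ (f : Fin 2 → SmoothFun n M) (p : M), B.1 f p = hkrValue α f p) ∧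
        Φ α = HochschildCochain.cohomologyClass (Dpoly n M) 1 B := by
  let φ : Tpoly n M 1 →ₗ[SmoothFun n M] HochschildCochain.Cohomology (Dpoly n M) 1 :=
    HochschildCochain.cohomologyClass (Dpoly n M) 1 ∘ₗ hkrCocycle
  -- A cochain `U₁(α)` that is a coboundary is both symmetric and antisymmetric, hence zero.
  have hinj : Function.Injective φ := by
    refine (injective_iff_map_eq_zero φ).2 fun α hα => hkrCochain_injective ?_
    have hmem : hkrCochain α ∈ HochschildCochain.coboundaries (Dpoly n M) 1 :=
      (Submodule.Quotient.mk_eq_zero ((HochschildCochain.coboundaries (Dpoly n M) 1).submoduleOf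
        (HochschildCochain.cocycles (Dpoly n M) 1)) (x := hkrCocycle α)).1 hα
    refine HochschildCochain.ext fun f => ContMDiffMap.ext fun p => ?_
    have h1 := (hkrCochain_antisymm α (f 0) (f 1)).trans
      (congrArg Neg.neg (coboundary_symm hmem (f 0) (f 1)).symm)
    have hf2 : (![f 0, f 1] : Fin 2 → SmoothFun n M) = f := by
      funext i; fin_cases i <;> rfl
    rw [hf2] at h1
    have h2 : hkrCochain α f p = - hkrCochain α f p :=
      congrArg (fun φ : SmoothFun n M => φ p) h1
    change hkrCochain α f p = 0
    linarith
  have hsurj : Function.Surjective φ := by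
    intro x
    obtain ⟨⟨B, hB, hd⟩, rfl⟩ := Submodule.mkQ_surjective _ x
    obtain ⟨α, hα⟩ := exists_hkrCochain_eq_antisymm hB hd
    refine ⟨α, (Submodule.Quotient.eq _).2 ?_⟩
    change hkrCochain α - B ∈ HochschildCochain.coboundaries (Dpoly n M) 1
    -- By the choice of `α` the difference is `-(B(f, g) + B(g, f)) / 2`, a symmetric cocycle.
    refine mem_coboundaries_of_symm (Submodule.sub_mem _ (hkrCochain_mem_Dpoly α) hB) ?_
      fun f g => ContMDiffMap.ext fun p => ?_
    · rw [map_sub, differential_hkrCochain, (hd : HochschildCochain.differential _ _ _ B = 0),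
        sub_zero]
    · change hkrCochain α _ p - B _ p = hkrCochain α _ p - B _ p
      have h1 := hα f g p
      have h2 := hα g f p
      linarith
  exact ⟨LinearEquiv.ofBijective φ ⟨hinj, hsurj⟩, fun α => ⟨hkrCocycle α, fun _ _ => rfl, rfl⟩⟩
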